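/- **Setting.** Let $\mathcal T$ be a countable set of tasks with local distributions $\mathcal D_t$ on $\mathcal X\times\mathcal Y$, and assume: (1) there are $M$ component distributions $\tilde{\mathcal D}_m$ with joint densities $p_m(x,y)$ and weights $\pi^*_t\in\Delta^M$ (the probability simplex) such that $\mathcal D_t=\sum_m\pi^*_{tm}\tilde{\mathcal D}_m$ for all $t\in\mathcal T$; (2) the components have the same marginal density, $p_m(x)=p(x)$ for all $m$; (3) $\{h_\theta\}_{\theta\in\mathbb R^d}$ is a parameterized family of hypotheses whose convex hull lies in the hypothesis class $\mathcal H$, $\ell\ge 0$ is a real-valued loss, and there is $c\in\mathbb R$ such that for each $m$ some $\theta^*_m$ satisfies $\ell(h_{\theta_m^*}(x),y)=-\log p_m(y|x)+c$ for $\tilde{\mathcal D}_m$-almost every $(x,y)$. Clients $t=1,\dots,T$ (distinct tasks) hold fixed non-empty datasets $(s_t^{(i)})_{i\le n_t}$, $s_t^{(i)}=(x_t^{(i)},y_t^{(i)})$, with $0<p(x_t^{(i)})<\infty$. Put $n=\sum_t n_t$, $l(\theta;s_t^{(i)})=\ell(h_\theta(x_t^{(i)}),y_t^{(i)})$, and for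 $\Theta=(\theta_m)_m\in\mathbb R^{M\times d}$, $\Pi=(\pi_t)_t$ with $\pi_t\in\Delta^M$, $$f(\Theta,\Pi)=-\frac1n\sum_{t=1}^T\sum_{i=1}^{n_t}\log\Big(\sum_{m=1}^M\pi_{tm}\,p_m(x_t^{(i)})\,e^{c-l(\theta_m;s_t^{(i)})}\Big).$$ Assume moreover: (4) $f\ge f^*$ for some $f^*\in\mathbb R$; (5) each $\theta\mapsto l(\theta;s_t^{(i)})$ is $C^2$ and $L$-smooth (its gradient is $L$-Lipschitz); (6) client $t$ samples batches $\xi=(\xi_1,\dots,\xi_{B_t})$ of $B_t\ge1$ indices, each uniform on $\{1,\dots,n_t\}$ (possibly dependent on each other, e.g. drawn with or without replacement), and the mini-batch gradient $\frac1{B_t}\sum_r\nabla l(\theta;s_t^{(\xi_r)})$ is, for every $\theta$, an unbiased estimator of $\frac1{n_t}\sum_i\nabla l(\theta;s_t^{(i)})$ with variance at most $\sigma^2$; (7) there are $G,\beta$ such that for all $\alpha\in\Delta^M$ and $\theta\in\mathbb R^d$ $$\sum_t\frac{n_t}n\Big\|\frac1{n_t}\sum_i\sum_m\alpha_m\nabla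 l(\theta;s_t^{(i)})\Big\|^2\le G^2+\beta^2\Big\|\frac1n\sum_t\sum_i\sum_m\alpha_m\nabla l(\theta;s_t^{(i)})\Big\|^2 .$$ **Algorithm (FedEM with local SGD, $J\ge1$ local steps, step size $\eta$).** From any $\Theta^0\in\mathbb R^{M\times d}$ and $\Pi^0$ with rows in $\Delta^M$, round $k\ge1$ computes $q_t^k(i,m)\propto\pi^{k-1}_{tm}e^{-l(\theta_m^{k-1};s_t^{(i)})}$ (normalized to sum to $1$ over $m$), $\pi^k_{tm}=\frac1{n_t}\sum_iq_t^k(i,m)$ and $\theta_m^k=\sum_t\frac{n_t}n\theta^{k-1,J}_{m,t}$, where $\theta^{k-1,0}_{m,t}=\theta_m^{k-1}$ and $$\theta^{k-1,j+1}_{m,t}=\theta^{k-1,j}_{m,t}-\eta\,\frac1{B_t}\sum_{r=1}^{B_t}q_t^k(\xi_r,m)\,\nabla l(\theta^{k-1,j}_{m,t};s_t^{(\xi_r)}),$$ with a batch $\xi$ distributed as in (6); the draws for different triples $(k,j,t)$ are independent, with any coupling between different $m$. **Theorem.** Let $a_0>0$. There are $C$ and $K_0$, not depending on $K$, such that for every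 $K\ge K_0$ the iterates of FedEM with $\eta=a_0/\sqrt K$ satisfy $$\frac1K\sum_{k=1}^K\mathbb E\big\|\nabla_\Theta f(\Theta^k,\Pi^k)\big\|_F^2\le\frac C{\sqrt K},\qquad \frac1K\sum_{k=1}^K\mathbb E\big[\Delta_\Pi f(\Theta^k,\Pi^k)\big]\le\frac C{K^{3/4}},$$ where $\Delta_\Pi f(\Theta^k,\Pi^k)=f(\Theta^k,\Pi^k)-f(\Theta^k,\Pi^{k+1})\ge0$ and the (finite) expectations are over the random batches. -/

import Mathlib

open MeasureTheory ProbabilityTheory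
open scoped NNReal ENNReal

noncomputable section

namespace FedEM

/-- Parameters `θ ∈ ℝ^d` of one component, with the Euclidean norm. -/
abbrev Theta (d : ℕ) := EuclideanSpace ℝ (Fin d)

/-- Matrices `Θ ∈ ℝ^{M × d}`, given by their rows `θ_m`. The norm is the Frobenius norm. -/
abbrev Params (M d : ℕ) := PiLp 2 (fun _ : Fin M => Theta d)

/-! ### The statistical model -/

section Model

variable {X Y Z 𝒯 : Type*} [MeasurableSpace X] [MeasurableSpace Y] {T M d : ℕ}

/-- The local distributions `D t` are mixtures of the component distributions `D' m` with weights
`w t` in the simplex: a latent label is drawn from the categorical distribution `w t` and,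
given label `m`, the pair `(x, y)` is drawn from `D' m`. -/
def IsMixture (D : 𝒯 → Measure (X × Y)) (D' : Fin M → Measure (X × Y)) (w : 𝒯 → Fin M → ℝ) :
    Prop :=
  ∀ t, w t ∈ stdSimplex ℝ (Fin M) ∧ D t = ∑ m, ENNReal.ofReal (w t m) • D' m

/-- The marginal density `p(x) = ∫ p(x, y) dy` of a joint density. -/
def marginal (μY : Measure Y) (p : X × Y → ℝ≥0∞) (x : X) : ℝ≥0∞ := ∫⁻ y, p (x, y) ∂μY

/-- The conditional density `p(y | x) = p(x, y) / p(x)` of a joint density. -/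
def condDensity (μY : Measure Y) (p : X × Y → ℝ≥0∞) (s : X × Y) : ℝ :=
  (p s / marginal μY p s.1).toReal

/-- Every component distribution is realized by some hypothesis `h θ`, in the sense that the loss
of that hypothesis is the log-loss `- log p_m(y | x) + c`. -/
def LogLossRealizable (μY : Measure Y) (D' : Fin M → Measure (X × Y))
    (p : Fin M → X × Y → ℝ≥0∞) (h : Theta d → X → Z) (ℓ : Z → Y → ℝ≥0) (c : ℝ) : Prop :=
  ∀ m, ∃ θ : Theta d, ∀ᵐ s ∂(D' m),
    (ℓ (h θ s.1) s.2 : ℝ) = - Real.log (condDensity μY (p m) s) + c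

/-- The conditional density `p_θ(y | x) = exp (c - ℓ(h_θ(x), y))` that the hypothesis `h_θ`
describes when `ℓ` is the log-loss with normalization constant `c`. -/
def modelCond (h : Theta d → X → Z) (ℓ : Z → Y → ℝ≥0) (c : ℝ) (θ : Theta d) (s : X × Y) : ℝ :=
  Real.exp (c - ℓ (h θ s.1) s.2)

/-- The likelihood `p(s | Θ, π) = ∑ m, π_m p_m(x) p_{θ_m}(y | x)` of one sample. -/
def likelihood (μY : Measure Y) (p : Fin M → X × Y → ℝ≥0∞) (h : Theta d → X → Z)
    (ℓ : Z → Y → ℝ≥0) (c : ℝ) (Θ : Params M d) (w : Fin M → ℝ) (s : X × Y) : ℝ :=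
  ∑ m, w m * (marginal μY (p m) s.1).toReal * modelCond h ℓ c (Θ m) s

/-- The objective `f(Θ, Π) = - (1/n) ∑ t, ∑ i, log p(s_t^i | Θ, π_t)`. -/
def objective (μY : Measure Y) (p : Fin M → X × Y → ℝ≥0∞) (h : Theta d → X → Z)
    (ℓ : Z → Y → ℝ≥0) (c : ℝ) {n : Fin T → ℕ} (S : (t : Fin T) → Fin (n t) → X × Y)
    (Θ : Params M d) (W : Fin T → Fin M → ℝ) : ℝ :=
  - (1 / ((∑ t, n t : ℕ) : ℝ)) *
    ∑ t, ∑ i, Real.log (likelihood μY p h ℓ c Θ (W t) (S t i))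

/-- The loss `l(θ; s_t^i) = ℓ(h_θ(x_t^i), y_t^i)` of sample `i` of client `t`. -/
def sampleLoss (h : Theta d → X → Z) (ℓ : Z → Y → ℝ≥0) {n : Fin T → ℕ}
    (S : (t : Fin T) → Fin (n t) → X × Y) (t : Fin T) (i : Fin (n t)) (θ : Theta d) : ℝ :=
  ℓ (h θ (S t i).1) (S t i).2

end Model

/-! ### The algorithm, in terms of the sample losses `l t i` -/

section Algorithm

variable {T M d : ℕ} {n B : Fin T → ℕ}

/-- E-step: the responsibilities `q_t(z_t^i = m) ∝ π_{tm} exp (- l(θ_m; s_t^i))`. -/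
def eStep (l : (t : Fin T) → Fin (n t) → Theta d → ℝ) (Θ : Params M d) (W : Fin T → Fin M → ℝ)
    (t : Fin T) (i : Fin (n t)) (m : Fin M) : ℝ :=
  W t m * Real.exp (- l t i (Θ m)) / ∑ m', W t m' * Real.exp (- l t i (Θ m'))

/-- Update of the mixture weights: the averages of the responsibilities. -/
def weightStep (l : (t : Fin T) → Fin (n t) → Theta d → ℝ) (Θ : Params M d)
    (W : Fin T → Fin M → ℝ) (t : Fin T) (m : Fin M) : ℝ :=
  (∑ i, eStep l Θ W t i m) / n t

/-- The mini-batch gradient with sample weights `q`: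
`(1/b) ∑ r, q_{ξ_r} ∇ l_{ξ_r}(θ)` over the batch `ξ_1, …, ξ_b` of sample indices. -/
def batchGrad {N b : ℕ} (l : Fin N → Theta d → ℝ) (q : Fin N → ℝ) (ξ : Fin b → Fin N)
    (θ : Theta d) : Theta d :=
  (1 / (b : ℝ)) • ∑ r, q (ξ r) • gradient (l (ξ r)) θ

/-- `j` steps of local SGD from `θ` with step size `η`, sample weights `q` and batches
`ξ 0, ξ 1, …`. -/
def localSGD {N b : ℕ} (l : Fin N → Theta d → ℝ) (q : Fin N → ℝ) (η : ℝ)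
    (ξ : ℕ → Fin b → Fin N) (θ : Theta d) : ℕ → Theta d
  | 0 => θ
  | j + 1 => localSGD l q η ξ θ j - η • batchGrad l q (ξ j) (localSGD l q η ξ θ j)

/-- The pair `(Θ^k, Π^k)` after `k` communication rounds from `(Θ₀, W₀)`, with `J` local steps of
size `η`. The batch that client `t` uses in local step `j` of round `k + 1` for component `m`
is `ξ k j t m`. -/
def iterates (l : (t : Fin T) → Fin (n t) → Theta d → ℝ) (J : ℕ) (η : ℝ)
    (ξ : ℕ → ℕ → (t : Fin T) → Fin M → Fin (B t) → Fin (n t))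
    (Θ₀ : Params M d) (W₀ : Fin T → Fin M → ℝ) : ℕ → Params M d × (Fin T → Fin M → ℝ)
  | 0 => (Θ₀, W₀)
  | k + 1 =>
    let Θ := (iterates l J η ξ Θ₀ W₀ k).1
    let W := (iterates l J η ξ Θ₀ W₀ k).2
    (WithLp.toLp 2 fun m => ∑ t, ((n t : ℝ) / ((∑ t', n t' : ℕ) : ℝ)) •
        localSGD (l t) (fun i => eStep l Θ W t i m) η (fun j => ξ k j t m) (Θ m) J,
      weightStep l Θ W)

/-- Batch laws under which each index of the batch is uniform on the local dataset. The indices of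
a batch may depend on each other (sampling with or without replacement). -/
def UniformBatches (ν : (t : Fin T) → Measure (Fin (B t) → Fin (n t))) : Prop :=
  ∀ t r i, ν t {ξ | ξ r = i} = ((n t : ℝ≥0∞))⁻¹

/-- The random batches of a run: the draws of different rounds, local steps and clients are
independent, and each batch of client `t` has law `ν t`. No restriction is put on how the batches
for different components are coupled within one local step, so that one common batch as well as
independent ones are allowed. -/
structure IsBatchSampling {Ω : Type*} [MeasurableSpace Ω] (P : Measure Ω)
    (ν : (t : Fin T) → Measure (Fin (B t) → Fin (n t)))
    (ξ : ℕ → ℕ → (t : Fin T) → Ω → Fin M → Fin (B t) → Fin (n t)) : Prop where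
  measurable : ∀ k j t, Measurable (ξ k j t)
  law : ∀ k j t m, P.map (fun ω => ξ k j t ω m) = ν t
  indep : iIndepFun (fun (a : ℕ × ℕ × Fin T) (ω : Ω) => ξ a.1 a.2.1 a.2.2 ω) P

end Algorithm

/-! ### Assumptions on the sample losses -/

section Assumptions

variable {T d : ℕ} {n B : Fin T → ℕ}

/-- Every sample loss is twice continuously differentiable and `L`-smooth. -/
def SmoothLosses (l : (t : Fin T) → Fin (n t) → Theta d → ℝ) (L : ℝ≥0) : Prop :=
  ∀ t i, ContDiff ℝ 2 (l t i) ∧ LipschitzWith L (gradient (l t i))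

/-- The gradient `(1/n_t) ∑ i, ∇ l(θ; s_t^i)` of the local empirical loss. -/
def localGrad (l : (t : Fin T) → Fin (n t) → Theta d → ℝ) (t : Fin T) (θ : Theta d) : Theta d :=
  (1 / (n t : ℝ)) • ∑ i, gradient (l t i) θ

/-- The mini-batch gradient is an unbiased estimator of the local gradient, with variance at most
`σ ^ 2`. -/
def UnbiasedBoundedVariance (l : (t : Fin T) → Fin (n t) → Theta d → ℝ)
    (ν : (t : Fin T) → Measure (Fin (B t) → Fin (n t))) (σ : ℝ) : Prop :=
  ∀ t θ, ∫ ξ, batchGrad (l t) (fun _ => 1) ξ θ ∂(ν t) = localGrad l t θ ∧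
    ∫ ξ, ‖batchGrad (l t) (fun _ => 1) ξ θ - localGrad l t θ‖ ^ 2 ∂(ν t) ≤ σ ^ 2

/-- Bounded dissimilarity of the gradients of the clients, with constants `G` and `β`. -/
def BoundedDissimilarity (M : ℕ) (l : (t : Fin T) → Fin (n t) → Theta d → ℝ) (G β : ℝ) : Prop :=
  ∀ α ∈ stdSimplex ℝ (Fin M), ∀ θ : Theta d,
    ∑ t, ((n t : ℝ) / ((∑ t', n t' : ℕ) : ℝ)) *
        ‖(1 / (n t : ℝ)) • ∑ i, ∑ m, α m • gradient (l t i) θ‖ ^ 2 ≤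
      G ^ 2 + β ^ 2 *
        ‖(1 / ((∑ t', n t' : ℕ) : ℝ)) • ∑ t, ∑ i, ∑ m, α m • gradient (l t i) θ‖ ^ 2

end Assumptions

end FedEM

end

/-!
The losses are nonnegative and the components share their marginal density. So the objective equals,
up to an additive constant, the averaged negative log-likelihood
`F(Θ, Π) = - (1/n) ∑ t, ∑ i, log (∑ m, π_{tm} exp (- l(θ_m; s_t^i)))`, which is nonnegative
(`negLogLik`, `objective_eq_negLogLik_add`).

*Descent.* By Jensen's inequality, the responsibilities `q` at `(Θ, Π)` give a majorant of `F` that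
is tight at `(Θ, Π)`, has there the gradient of `F` in `Θ`, and is smooth; replacing `Π` by the
averages of `q` lowers it by a relative entropy (`negLogLik_le_surrogate`,
`negLogLik_le_add_inner`).

*Control of the noise by the objective.* A nonnegative function with `Λ`-Lipschitz gradient satisfies
`‖∇l‖² ≤ 4 Λ l`, and `∑ m, q_m l_m` is at most the negative log-likelihood of the sample. Hence every
weighted sample gradient `q ∇l` at the start of a round satisfies `‖q ∇l‖² ≤ 4 Λ n F`
(`norm_eStep_smul_gradient_sq_le`). Therefore, for every outcome of the batches, local SGD moves by at
most `O(η √F)`, and up to `O(η² √F)` its displacement is the one obtained when all batch gradients are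
evaluated at the start of the round (`norm_localSGD_sub_le`, `norm_localSGD_sub_add_le`). The
batches of the round are independent of the past and their indices are uniform, so in expectation
this displacement is `- η J ∇F` (`integral_batchPairing`). The outcome is
`E F_{k+1} ≤ (1 + c η²) E F_k - η J E ‖∇F_k‖²` (`integral_negLogLik_succ_le`). With
`η² = a₀² / K`, the factors `1 + c η²` of `K` rounds have a bounded product, and the rate for the
gradients follows by summation.

*Weights.* Telescoping shows that the decreases through the weights sum to at most a constant plus the
increases of `F(·, Π^{k+1})` from `Θ^k` to `Θ^{k+1}`. In expectation such an increase is at most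
`- η J E ⟪∇F(Θ^k, Π^{k+1}), ∇F(Θ^k, Π^k)⟫ + c η² E F_k`. The first gradient is only known to be
`O(√F)`, so the pairing is split by the inequality of arithmetic and geometric means with weight
`s = K^{1/4}` (`neg_inner_mixGrad_le`, `integral_weight_decrease_le`); this gives the rate
`K^{-3/4}` (`rates_of_recursion`).
-/

namespace FedEM

/-! ### Smooth nonnegative functions -/

section Smooth

variable {E : Type*} [NormedAddCommGroup E] [InnerProductSpace ℝ E] [CompleteSpace E]

/-- The descent inequality, with the constant `Λ` that the mean value theorem gives instead of the
optimal `Λ / 2`. -/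
theorem le_add_inner_gradient_add {g : E → ℝ} {Λ : ℝ} (hd : Differentiable ℝ g)
    (hg : ∀ x y, ‖gradient g x - gradient g y‖ ≤ Λ * ‖x - y‖) (hΛ : 0 ≤ Λ) (x y : E) :
    g y ≤ g x + inner ℝ (gradient g x) (y - x) + Λ * ‖y - x‖ ^ 2 := by
  obtain ⟨z, hz, hzeq⟩ := domain_mvt (f := g)
    (f' := fun z => InnerProductSpace.toDual ℝ E (gradient g z)) (s := Set.univ) (x := x) (y := y)
    (fun z _ => ((hd z).hasGradientAt.hasFDerivAt).hasFDerivWithinAt) convex_univ trivial trivial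
  rw [InnerProductSpace.toDual_apply_apply] at hzeq
  have h1 : ‖z - x‖ ≤ ‖y - x‖ := by
    simpa [dist_eq_norm] using
      (convex_closedBall x ‖y - x‖).segment_subset (by simp) (by simp [dist_eq_norm]) hz
  have h2 : inner ℝ (gradient g z - gradient g x) (y - x) ≤ Λ * ‖y - x‖ ^ 2 :=
    calc inner ℝ (gradient g z - gradient g x) (y - x)
        ≤ ‖gradient g z - gradient g x‖ * ‖y - x‖ := real_inner_le_norm _ _
      _ ≤ (Λ * ‖y - x‖) * ‖y - x‖ := by
        gcongr
        exact (hg z x).trans (by gcongr)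
      _ = Λ * ‖y - x‖ ^ 2 := by ring
  rw [inner_sub_left] at h2
  linarith

/-- A nonnegative function with Lipschitz gradient controls the square of its gradient. -/
theorem norm_gradient_sq_le {g : E → ℝ} {Λ : ℝ} (hd : Differentiable ℝ g)
    (hg : ∀ x y, ‖gradient g x - gradient g y‖ ≤ Λ * ‖x - y‖) (hΛ : 0 < Λ) (h0 : ∀ x, 0 ≤ g x)
    (x : E) : ‖gradient g x‖ ^ 2 ≤ 4 * Λ * g x := by
  -- One gradient step of length `1 / (2 Λ)` decreases `g` by `‖∇g‖² / (4 Λ)`.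
  have h := le_add_inner_gradient_add hd hg hΛ.le x (x - (1 / (2 * Λ)) • gradient g x)
  have h' := h0 (x - (1 / (2 * Λ)) • gradient g x)
  rw [sub_sub_cancel_left, inner_neg_right, real_inner_smul_right, real_inner_self_eq_norm_sq,
    norm_neg, norm_smul, mul_pow, Real.norm_eq_abs, sq_abs] at h
  have h2 : Λ * ((1 / (2 * Λ)) ^ 2 * ‖gradient g x‖ ^ 2) = ‖gradient g x‖ ^ 2 / (4 * Λ) := by
    field_simp; ring
  have h3 : 1 / (2 * Λ) * ‖gradient g x‖ ^ 2 = 2 * (‖gradient g x‖ ^ 2 / (4 * Λ)) := by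
    field_simp; ring
  have h4 : ‖gradient g x‖ ^ 2 / (4 * Λ) ≤ g x := by linarith
  rw [div_le_iff₀ (by positivity)] at h4
  linarith

end Smooth

/-! ### The variational bound for mixtures -/

section Mixture

variable {M : ℕ}

/-- Jensen's inequality for mixtures: the change of `- log ∑ w e^{-a}` is bounded by averages under
the responsibilities at the old point. -/
theorem neg_log_mixture_le {w w' a b : Fin M → ℝ} (hw : ∀ m, 0 ≤ w m) (hw' : ∀ m, 0 ≤ w' m)
    (hpos : 0 < ∑ m, w m * Real.exp (-a m)) (hac : ∀ m, 0 < w m → 0 < w' m) :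
    -Real.log (∑ m, w' m * Real.exp (-b m)) ≤ -Real.log (∑ m, w m * Real.exp (-a m)) +
      ∑ m, w m * Real.exp (-a m) / (∑ m', w m' * Real.exp (-a m')) *
        (b m - a m - Real.log (w' m / w m)) := by
  set Z := ∑ m, w m * Real.exp (-a m) with hZ
  set Z' := ∑ m, w' m * Real.exp (-b m) with hZ'
  have hZ'pos : 0 < Z' := by
    obtain ⟨m, -, hm⟩ := Finset.exists_lt_of_sum_lt (s := Finset.univ)
      (f := fun _ : Fin M => (0 : ℝ)) (g := fun m => w m * Real.exp (-a m)) (by simpa using hpos)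
    refine Finset.sum_pos' (fun m _ => mul_nonneg (hw' m) (Real.exp_pos _).le)
      ⟨m, Finset.mem_univ _, mul_pos (hac m ?_) (Real.exp_pos _)⟩
    exact (pos_iff_pos_of_mul_pos hm).2 (Real.exp_pos _)
  have key : ∀ m, w m * Real.exp (-a m) / Z *
      (Real.log Z - Real.log Z' - (b m - a m - Real.log (w' m / w m))) ≤
      w' m * Real.exp (-b m) / Z' - w m * Real.exp (-a m) / Z := by
    intro m
    rcases (hw m).eq_or_lt with h | h
    · rw [← h]
      have := mul_nonneg (hw' m) (Real.exp_pos (-b m)).le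
      simp only [zero_mul, zero_div, sub_zero]
      positivity
    · have hw'm := hac m h
      have e1 := Real.exp_pos (-a m)
      have e2 := Real.exp_pos (-b m)
      have hq : 0 < w m * Real.exp (-a m) / Z := by positivity
      have hr : 0 < w' m * Real.exp (-b m) / Z' := by positivity
      have hlog : Real.log Z - Real.log Z' - (b m - a m - Real.log (w' m / w m)) =
          Real.log ((w' m * Real.exp (-b m) / Z') / (w m * Real.exp (-a m) / Z)) := by
        rw [Real.log_div hr.ne' hq.ne', Real.log_div (by positivity) hZ'pos.ne',
          Real.log_div (by positivity) hpos.ne', Real.log_mul hw'm.ne' e2.ne',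
          Real.log_mul h.ne' e1.ne', Real.log_div hw'm.ne' h.ne', Real.log_exp, Real.log_exp]
        ring
      rw [hlog]
      calc _ ≤ w m * Real.exp (-a m) / Z *
            ((w' m * Real.exp (-b m) / Z') / (w m * Real.exp (-a m) / Z) - 1) := by
            gcongr
            exact Real.log_le_sub_one_of_pos (by positivity)
        _ = _ := by rw [mul_sub, mul_div_cancel₀ _ hq.ne', mul_one]
  have hsum := Finset.sum_le_sum (s := Finset.univ) fun m _ => key m
  have hone : ∑ m, w m * Real.exp (-a m) / Z = 1 := by rw [← Finset.sum_div, div_self hpos.ne']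
  have hone' : ∑ m, w' m * Real.exp (-b m) / Z' = 1 := by
    rw [← Finset.sum_div, div_self hZ'pos.ne']
  rw [Finset.sum_sub_distrib, hone, hone'] at hsum
  simp only [mul_sub (_ / Z)] at hsum ⊢
  simp only [Finset.sum_sub_distrib, ← Finset.sum_mul, hone] at hsum ⊢
  linarith

/-- Nonnegativity of the relative entropy on the simplex. -/
theorem sum_mul_log_div_nonneg {w w' : Fin M → ℝ} (hw : w ∈ stdSimplex ℝ (Fin M))
    (hw' : w' ∈ stdSimplex ℝ (Fin M)) (hac : ∀ m, w m = 0 → w' m = 0) :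
    0 ≤ ∑ m, w' m * Real.log (w' m / w m) := by
  have h : ∀ m, w' m - w m ≤ w' m * Real.log (w' m / w m) := by
    intro m
    rcases (hw'.1 m).eq_or_lt with h' | h'
    · simpa [← h'] using hw.1 m
    · have hwm : 0 < w m := (hw.1 m).lt_of_ne fun h0 => h'.ne' (hac m h0.symm)
      have h1 := Real.log_le_sub_one_of_pos (div_pos hwm h')
      rw [← inv_div, Real.log_inv]
      calc w' m - w m = w' m * -(w m / w' m - 1) := by field_simp; ring
        _ ≤ _ := by gcongr
  have := Finset.sum_le_sum (s := Finset.univ) fun m _ => h m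
  rw [Finset.sum_sub_distrib, hw.2, hw'.2] at this
  linarith

end Mixture

/-! ### The negative log-likelihood and its gradient -/

section Objective

variable {T M d : ℕ} {n B : Fin T → ℕ}

/-- Nonnegative differentiable sample losses whose gradients are `Λ`-Lipschitz, for a positive
real `Λ`. -/
structure RegularLosses (l : (t : Fin T) → Fin (n t) → Theta d → ℝ) (Λ : ℝ) : Prop where
  pos : 0 < Λ
  nonneg : ∀ t i θ, 0 ≤ l t i θ
  diff : ∀ t i, Differentiable ℝ (l t i)
  lip : ∀ t i θ θ', ‖gradient (l t i) θ - gradient (l t i) θ'‖ ≤ Λ * ‖θ - θ'‖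

/-- The unnormalized likelihood `∑ m, π_{tm} exp (- l(θ_m; s_t^i))` of sample `i` of client `t`. -/
noncomputable def mixture (l : (t : Fin T) → Fin (n t) → Theta d → ℝ) (Θ : Params M d)
    (W : Fin T → Fin M → ℝ) (t : Fin T) (i : Fin (n t)) : ℝ :=
  ∑ m, W t m * Real.exp (-l t i (Θ m))

/-- The averaged negative log-likelihood `- (1/n) ∑ t, ∑ i, log (∑ m, π_{tm} exp (- l(θ_m; s_t^i)))`.
It differs from the objective by a constant, and it is nonnegative because the losses are. -/
noncomputable def negLogLik (l : (t : Fin T) → Fin (n t) → Theta d → ℝ) (Θ : Params M d)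
    (W : Fin T → Fin M → ℝ) : ℝ :=
  (1 / ((∑ t, n t : ℕ) : ℝ)) * ∑ t, ∑ i, -Real.log (mixture l Θ W t i)

/-- The gradient of `negLogLik` in the parameters: row `m` averages the gradients of the sample
losses with the responsibilities of component `m`. -/
noncomputable def mixGrad (l : (t : Fin T) → Fin (n t) → Theta d → ℝ) (Θ : Params M d)
    (W : Fin T → Fin M → ℝ) : Params M d :=
  WithLp.toLp 2 fun m =>
    (1 / ((∑ t, n t : ℕ) : ℝ)) • ∑ t, ∑ i, eStep l Θ W t i m • gradient (l t i) (Θ m)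

variable {l : (t : Fin T) → Fin (n t) → Theta d → ℝ} {Λ : ℝ} {Θ Θ' : Params M d}
  {W W' : Fin T → Fin M → ℝ}

theorem mixGrad_apply (m : Fin M) : mixGrad l Θ W m =
    (1 / ((∑ t, n t : ℕ) : ℝ)) • ∑ t, ∑ i, eStep l Θ W t i m • gradient (l t i) (Θ m) := rfl

theorem mixture_pos (l : (t : Fin T) → Fin (n t) → Theta d → ℝ) (Θ : Params M d)
    (hW : ∀ t, W t ∈ stdSimplex ℝ (Fin M)) (t : Fin T) (i : Fin (n t)) :
    0 < mixture l Θ W t i := by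
  obtain ⟨m, -, hm⟩ := Finset.exists_lt_of_sum_lt (s := Finset.univ)
    (f := fun _ : Fin M => (0 : ℝ)) (g := W t) (by simp [(hW t).2])
  exact Finset.sum_pos' (fun m _ => mul_nonneg ((hW t).1 m) (Real.exp_pos _).le)
    ⟨m, Finset.mem_univ _, mul_pos hm (Real.exp_pos _)⟩

theorem eStep_mem_stdSimplex (l : (t : Fin T) → Fin (n t) → Theta d → ℝ) (Θ : Params M d)
    (hW : ∀ t, W t ∈ stdSimplex ℝ (Fin M)) (t : Fin T) (i : Fin (n t)) :
    eStep l Θ W t i ∈ stdSimplex ℝ (Fin M) := by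
  have h := mixture_pos l Θ hW t i
  refine ⟨fun m => div_nonneg (mul_nonneg ((hW t).1 m) (Real.exp_pos _).le) h.le, ?_⟩
  simp only [eStep]
  rw [← Finset.sum_div]
  exact div_self h.ne'

theorem eStep_le_one (hW : ∀ t, W t ∈ stdSimplex ℝ (Fin M)) (t : Fin T) (i : Fin (n t))
    (m : Fin M) : eStep l Θ W t i m ≤ 1 := by
  have h := eStep_mem_stdSimplex l Θ hW t i
  rw [← h.2]
  exact Finset.single_le_sum (fun m _ => h.1 m) (Finset.mem_univ m)

theorem sum_eStep_eq (hn : ∀ t, 0 < n t) (t : Fin T) (m : Fin M) :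
    ∑ i, eStep l Θ W t i m = n t * weightStep l Θ W t m := by
  have : (n t : ℝ) ≠ 0 := by exact_mod_cast (hn t).ne'
  rw [weightStep]
  field_simp

theorem weightStep_mem_stdSimplex (l : (t : Fin T) → Fin (n t) → Theta d → ℝ) (Θ : Params M d)
    (hn : ∀ t, 0 < n t) (hW : ∀ t, W t ∈ stdSimplex ℝ (Fin M)) (t : Fin T) :
    weightStep l Θ W t ∈ stdSimplex ℝ (Fin M) := by
  have hn' : (n t : ℝ) ≠ 0 := by exact_mod_cast (hn t).ne'
  refine ⟨fun m => div_nonneg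
    (Finset.sum_nonneg fun i _ => (eStep_mem_stdSimplex l Θ hW t i).1 m) (by positivity), ?_⟩
  simp only [weightStep]
  rw [← Finset.sum_div, Finset.sum_comm, Finset.sum_congr rfl
    fun i _ => (eStep_mem_stdSimplex l Θ hW t i).2]
  simp [hn']

theorem weightStep_pos (hn : ∀ t, 0 < n t) (hW : ∀ t, W t ∈ stdSimplex ℝ (Fin M)) (t : Fin T)
    (m : Fin M) (h : 0 < W t m) : 0 < weightStep l Θ W t m := by
  have hn' : (0 : ℝ) < n t := by exact_mod_cast hn t
  have : Nonempty (Fin (n t)) := ⟨⟨0, hn t⟩⟩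
  exact div_pos (Finset.sum_pos (fun i _ => div_pos (mul_pos h (Real.exp_pos _))
    (mixture_pos l Θ hW t i)) Finset.univ_nonempty) hn'

theorem weightStep_eq_zero (t : Fin T) (m : Fin M) (h : W t m = 0) :
    weightStep l Θ W t m = 0 := by
  simp [weightStep, eStep, h]

/-- The responsibilities at the current point define a majorizing surrogate of `negLogLik`. New
weights are admissible when they do not decrease the expected log-weights. -/
theorem negLogLik_le_surrogate (hW : ∀ t, W t ∈ stdSimplex ℝ (Fin M))
    (hW' : ∀ t, W' t ∈ stdSimplex ℝ (Fin M)) (hac : ∀ t m, 0 < W t m → 0 < W' t m)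
    (hlog : ∀ t, 0 ≤ ∑ i, ∑ m, eStep l Θ W t i m * Real.log (W' t m / W t m)) :
    negLogLik l Θ' W' ≤ negLogLik l Θ W + (1 / ((∑ t, n t : ℕ) : ℝ)) *
      ∑ t, ∑ i, ∑ m, eStep l Θ W t i m * (l t i (Θ' m) - l t i (Θ m)) := by
  rw [negLogLik, negLogLik, ← mul_add]
  refine mul_le_mul_of_nonneg_left ?_ (by positivity)
  rw [← Finset.sum_add_distrib]
  refine Finset.sum_le_sum fun t _ => ?_
  rw [← Finset.sum_add_distrib]
  have h : ∀ i, -Real.log (mixture l Θ' W' t i) ≤ -Real.log (mixture l Θ W t i) +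
      ∑ m, eStep l Θ W t i m * (l t i (Θ' m) - l t i (Θ m) - Real.log (W' t m / W t m)) :=
    fun i => neg_log_mixture_le (hW t).1 (hW' t).1 (mixture_pos l Θ hW t i) (hac t)
  have := Finset.sum_le_sum (s := Finset.univ) fun i _ => h i
  refine this.trans ?_
  simp only [mul_sub, Finset.sum_sub_distrib, Finset.sum_add_distrib] at hlog ⊢
  linarith [hlog t]

theorem sum_eStep_mul_log_weightStep_nonneg (hn : ∀ t, 0 < n t)
    (hW : ∀ t, W t ∈ stdSimplex ℝ (Fin M)) (t : Fin T) :
    0 ≤ ∑ i, ∑ m, eStep l Θ W t i m * Real.log (weightStep l Θ W t m / W t m) := by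
  rw [Finset.sum_comm]
  simp only [← Finset.sum_mul, sum_eStep_eq hn, mul_assoc]
  rw [← Finset.mul_sum]
  exact mul_nonneg (by positivity) (sum_mul_log_div_nonneg (hW t)
    (weightStep_mem_stdSimplex l Θ hn hW t) fun m => weightStep_eq_zero t m)

theorem sum_eStep_mul_log_div_self (t : Fin T) :
    0 ≤ ∑ i, ∑ m, eStep l Θ W t i m * Real.log (W t m / W t m) := by
  refine Finset.sum_nonneg fun i _ => Finset.sum_nonneg fun m _ => ?_
  rcases eq_or_ne (W t m) 0 with h | h <;> simp [h]

theorem negLogLik_weightStep_le (hn : ∀ t, 0 < n t) (hW : ∀ t, W t ∈ stdSimplex ℝ (Fin M)) :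
    negLogLik l Θ (weightStep l Θ W) ≤ negLogLik l Θ W := by
  simpa using negLogLik_le_surrogate (l := l) (Θ := Θ) (Θ' := Θ) hW
    (weightStep_mem_stdSimplex l Θ hn hW) (weightStep_pos hn hW)
    (sum_eStep_mul_log_weightStep_nonneg hn hW)

/-- The expected loss under the responsibilities is at most the negative log-likelihood. -/
theorem sum_eStep_mul_le (hW : ∀ t, W t ∈ stdSimplex ℝ (Fin M)) (t : Fin T) (i : Fin (n t)) :
    ∑ m, eStep l Θ W t i m * l t i (Θ m) ≤ -Real.log (mixture l Θ W t i) := by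
  -- Compare with a mixture of zero losses, whose negative log-likelihood is zero.
  have h := neg_log_mixture_le (w := W t) (w' := W t) (a := fun m => l t i (Θ m))
    (b := fun _ => 0) (hW t).1 (hW t).1 (mixture_pos l Θ hW t i) fun m hm => hm
  have h2 : ∀ m, eStep l Θ W t i m * (0 - l t i (Θ m) - Real.log (W t m / W t m)) =
      -(eStep l Θ W t i m * l t i (Θ m)) := by
    intro m
    rcases eq_or_ne (W t m) 0 with h | h <;> simp [h]
  have h3 := Finset.sum_congr rfl fun m (_ : m ∈ Finset.univ) => h2 m
  simp only [neg_zero, Real.exp_zero, mul_one, (hW t).2, Real.log_one] at h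
  rw [Finset.sum_neg_distrib] at h3
  simp only [mixture, eStep] at h3 ⊢
  linarith

theorem neg_log_mixture_nonneg (hl : RegularLosses l Λ) (hW : ∀ t, W t ∈ stdSimplex ℝ (Fin M))
    (t : Fin T) (i : Fin (n t)) : 0 ≤ -Real.log (mixture l Θ W t i) :=
  (Finset.sum_nonneg fun m _ => mul_nonneg ((eStep_mem_stdSimplex l Θ hW t i).1 m)
    (hl.nonneg t i _)).trans (sum_eStep_mul_le hW t i)

theorem negLogLik_nonneg (hl : RegularLosses l Λ) (hW : ∀ t, W t ∈ stdSimplex ℝ (Fin M)) :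
    0 ≤ negLogLik l Θ W :=
  mul_nonneg (by positivity) (Finset.sum_nonneg fun t _ => Finset.sum_nonneg fun i _ =>
    neg_log_mixture_nonneg hl hW t i)

theorem sum_pos_of_index (hn : ∀ t, 0 < n t) (t : Fin T) : (0 : ℝ) < ((∑ t, n t : ℕ) : ℝ) := by
  exact_mod_cast (hn t).trans_le (Finset.single_le_sum (f := n) (fun _ _ => Nat.zero_le _)
    (Finset.mem_univ t))

/-- The gradients of the sample losses may be unbounded, but once weighted by the responsibilities
they are controlled by the objective. -/
theorem norm_eStep_smul_gradient_sq_le (hl : RegularLosses l Λ) (hn : ∀ t, 0 < n t)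
    (hW : ∀ t, W t ∈ stdSimplex ℝ (Fin M)) (t : Fin T) (i : Fin (n t)) (m : Fin M) :
    ‖eStep l Θ W t i m • gradient (l t i) (Θ m)‖ ^ 2 ≤
      4 * Λ * ((∑ t, n t : ℕ) : ℝ) * negLogLik l Θ W := by
  have hq := eStep_mem_stdSimplex l Θ hW t i
  have hN := sum_pos_of_index hn t
  have hΛ := hl.pos
  have h1 : -Real.log (mixture l Θ W t i) ≤ ((∑ t, n t : ℕ) : ℝ) * negLogLik l Θ W := by
    rw [negLogLik, ← mul_assoc, mul_one_div_cancel hN.ne', one_mul]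
    exact (Finset.single_le_sum (f := fun i => -Real.log (mixture l Θ W t i))
      (fun i _ => neg_log_mixture_nonneg hl hW t i) (Finset.mem_univ i)).trans
      (Finset.single_le_sum (f := fun t => ∑ i, -Real.log (mixture l Θ W t i))
        (fun t _ => Finset.sum_nonneg fun i _ => neg_log_mixture_nonneg hl hW t i)
        (Finset.mem_univ t))
  have h2 : eStep l Θ W t i m * l t i (Θ m) ≤ -Real.log (mixture l Θ W t i) :=
    (Finset.single_le_sum (f := fun m => eStep l Θ W t i m * l t i (Θ m))
      (fun m _ => mul_nonneg (hq.1 m) (hl.nonneg t i _)) (Finset.mem_univ m)).trans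
      (sum_eStep_mul_le hW t i)
  rw [norm_smul, mul_pow, Real.norm_eq_abs, sq_abs]
  calc eStep l Θ W t i m ^ 2 * ‖gradient (l t i) (Θ m)‖ ^ 2
      ≤ eStep l Θ W t i m * (4 * Λ * l t i (Θ m)) := by
        refine mul_le_mul ?_ (norm_gradient_sq_le (hl.diff t i) (hl.lip t i) hΛ (hl.nonneg t i) _)
          (by positivity) (hq.1 m)
        have := eStep_le_one (l := l) (Θ := Θ) hW t i m
        nlinarith [hq.1 m]
    _ = 4 * Λ * (eStep l Θ W t i m * l t i (Θ m)) := by ring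
    _ ≤ 4 * Λ * (((∑ t, n t : ℕ) : ℝ) * negLogLik l Θ W) :=
        mul_le_mul_of_nonneg_left (h2.trans h1) (by positivity)
    _ = _ := by ring

theorem norm_mixGrad_row_le (hn : ∀ t, 0 < n t) {ρ : ℝ} (hρ : 0 ≤ ρ) (m : Fin M)
    (h : ∀ t i, ‖eStep l Θ W t i m • gradient (l t i) (Θ m)‖ ≤ ρ) :
    ‖mixGrad l Θ W m‖ ≤ ρ := by
  rcases isEmpty_or_nonempty (Fin T) with hT | ⟨⟨t₀⟩⟩
  · simpa [mixGrad] using hρ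
  have hN := sum_pos_of_index hn t₀
  rw [mixGrad_apply, norm_smul, Real.norm_eq_abs, abs_of_pos (by positivity), one_div_mul_eq_div,
    div_le_iff₀ hN]
  calc _ ≤ ∑ t, ∑ _i : Fin (n t), ρ := norm_sum_le_of_le _ fun t _ =>
        norm_sum_le_of_le _ fun i _ => h t i
    _ = _ := by simp [Finset.mul_sum, mul_comm]

theorem inner_mixGrad (A : Params M d) :
    inner ℝ (mixGrad l Θ W) A = (1 / ((∑ t, n t : ℕ) : ℝ)) *
      ∑ t, ∑ i, ∑ m, eStep l Θ W t i m * inner ℝ (gradient (l t i) (Θ m)) (A m) := by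
  rw [PiLp.inner_apply]
  simp only [mixGrad_apply, real_inner_smul_left, sum_inner, ← Finset.mul_sum]
  rw [Finset.sum_comm]
  exact congrArg _ (Finset.sum_congr rfl fun t _ => Finset.sum_comm)

theorem hasGradientAt_negLogLik (hl : RegularLosses l Λ) (hW : ∀ t, W t ∈ stdSimplex ℝ (Fin M))
    (Θ : Params M d) : HasGradientAt (fun Θ => negLogLik l Θ W) (mixGrad l Θ W) Θ := by
  rw [hasGradientAt_iff_hasFDerivAt]
  have h1 : ∀ t i m, HasFDerivAt (fun Θ : Params M d => l t i (Θ m))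
      ((InnerProductSpace.toDual ℝ _ (gradient (l t i) (Θ m))).comp
        (PiLp.proj 2 (𝕜 := ℝ) (fun _ : Fin M => Theta d) m)) Θ := fun t i m =>
    HasFDerivAt.comp Θ (f := fun Θ : Params M d => Θ m)
      ((hl.diff t i (Θ m)).hasGradientAt.hasFDerivAt)
      (PiLp.proj 2 (𝕜 := ℝ) (fun _ : Fin M => Theta d) m).hasFDerivAt
  have h2 : ∀ t i, HasFDerivAt (fun Θ : Params M d => mixture l Θ W t i) _ Θ := fun t i =>
    HasFDerivAt.fun_sum fun m (_ : m ∈ Finset.univ) =>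
      ((h1 t i m).neg.exp).const_mul (W t m)
  have h3 := HasFDerivAt.const_mul (HasFDerivAt.fun_sum fun t (_ : t ∈ Finset.univ) =>
    HasFDerivAt.fun_sum fun i (_ : i ∈ Finset.univ) =>
      ((h2 t i).log (mixture_pos l Θ hW t i).ne').neg) (1 / ((∑ t, n t : ℕ) : ℝ))
  refine h3.congr_fderiv ?_
  ext A
  rw [InnerProductSpace.toDual_apply_apply, inner_mixGrad]
  simp only [smul_apply, sum_apply, neg_apply, Pi.neg_apply, ContinuousLinearMap.comp_apply, smul_eq_mul,
    InnerProductSpace.toDual_apply_apply, PiLp.proj_apply, Finset.mul_sum, eStep, mixture]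
  refine Finset.sum_congr rfl fun t _ => Finset.sum_congr rfl fun i _ => ?_
  rw [← Finset.sum_neg_distrib, Finset.mul_sum]
  refine Finset.sum_congr rfl fun m _ => ?_
  ring

/-- The descent inequality for the joint update of parameters and weights. -/
theorem negLogLik_le_add_inner (hl : RegularLosses l Λ) (hW : ∀ t, W t ∈ stdSimplex ℝ (Fin M))
    (hW' : ∀ t, W' t ∈ stdSimplex ℝ (Fin M)) (hac : ∀ t m, 0 < W t m → 0 < W' t m)
    (hlog : ∀ t, 0 ≤ ∑ i, ∑ m, eStep l Θ W t i m * Real.log (W' t m / W t m)) :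
    negLogLik l Θ' W' ≤ negLogLik l Θ W + inner ℝ (mixGrad l Θ W) (Θ' - Θ) +
      Λ * ‖Θ' - Θ‖ ^ 2 := by
  have hΛ := hl.pos
  refine (negLogLik_le_surrogate hW hW' hac hlog (Θ' := Θ')).trans ?_
  rw [add_assoc, inner_mixGrad]
  refine (add_le_add_iff_left _).2 ?_
  have key : ∀ t i, ∑ m, eStep l Θ W t i m * (l t i (Θ' m) - l t i (Θ m)) ≤
      ∑ m, eStep l Θ W t i m * inner ℝ (gradient (l t i) (Θ m)) ((Θ' - Θ) m) +
        Λ * ‖Θ' - Θ‖ ^ 2 := by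
    intro t i
    rw [PiLp.norm_sq_eq_of_L2, Finset.mul_sum, ← Finset.sum_add_distrib]
    refine Finset.sum_le_sum fun m _ => ?_
    have h1 := le_add_inner_gradient_add (hl.diff t i) (hl.lip t i) hΛ.le (Θ m) (Θ' m)
    have h2 := (eStep_mem_stdSimplex l Θ hW t i).1 m
    have h3 := eStep_le_one (l := l) (Θ := Θ) hW t i m
    have h4 : 0 ≤ Λ * ‖(Θ' - Θ) m‖ ^ 2 := by positivity
    rw [PiLp.sub_apply] at h4 ⊢
    nlinarith [mul_le_mul_of_nonneg_left h1 h2, mul_le_mul_of_nonneg_right h3 h4]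
  refine (mul_le_mul_of_nonneg_left (Finset.sum_le_sum fun t _ => Finset.sum_le_sum fun i _ =>
    key t i) (by positivity)).trans ?_
  simp only [Finset.sum_add_distrib, mul_add]
  refine (add_le_add_iff_left _).2 ?_
  simp only [Finset.sum_const, Finset.card_univ, Fintype.card_fin, nsmul_eq_mul,
    ← Finset.sum_mul, ← Nat.cast_sum, ← mul_assoc]
  rcases eq_or_ne ((∑ t, n t : ℕ) : ℝ) 0 with h | h
  · rw [h]; simp; positivity
  · rw [one_div_mul_cancel h, one_mul]

end Objective

/-! ### Drift of local SGD -/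

section LocalSGD

variable {N b d : ℕ} {l : Fin N → Theta d → ℝ} {q : Fin N → ℝ} {Λ ρ η : ℝ} {θ : Theta d}

/-- A batch average is bounded by any common bound of its terms. -/
theorem norm_batch_average_le {E : Type*} [SeminormedAddCommGroup E] [NormedSpace ℝ E]
    (hb : 0 < b) {v : Fin b → E} {c : ℝ} (h : ∀ r, ‖v r‖ ≤ c) :
    ‖(1 / (b : ℝ)) • ∑ r, v r‖ ≤ c := by
  have hb' : (0 : ℝ) < b := by exact_mod_cast hb
  rw [norm_smul, Real.norm_eq_abs, abs_of_pos (by positivity), one_div_mul_eq_div,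
    div_le_iff₀ hb']
  refine (norm_sum_le_of_le _ fun r _ => h r).trans ?_
  simp [mul_comm]

theorem norm_batchGrad_sub_le (hb : 0 < b) (hq : ∀ i, |q i| ≤ 1)
    (hl : ∀ i θ θ', ‖gradient (l i) θ - gradient (l i) θ'‖ ≤ Λ * ‖θ - θ'‖)
    (ξ : Fin b → Fin N) (θ θ' : Theta d) :
    ‖batchGrad l q ξ θ - batchGrad l q ξ θ'‖ ≤ Λ * ‖θ - θ'‖ := by
  rw [batchGrad, batchGrad, ← smul_sub, ← Finset.sum_sub_distrib]
  refine norm_batch_average_le hb fun r => ?_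
  rw [← smul_sub, norm_smul, Real.norm_eq_abs]
  calc |q (ξ r)| * ‖gradient (l (ξ r)) θ - gradient (l (ξ r)) θ'‖
      ≤ 1 * (Λ * ‖θ - θ'‖) := by gcongr; exacts [hq _, hl _ _ _]
    _ = _ := one_mul _

/-- The iterates of local SGD stay within `O(η)` of their starting point, whatever the batches, if
the weighted sample gradients at the starting point are bounded by `ρ`. -/
theorem norm_localSGD_sub_le (hb : 0 < b) (hq : ∀ i, |q i| ≤ 1)
    (hl : ∀ i θ θ', ‖gradient (l i) θ - gradient (l i) θ'‖ ≤ Λ * ‖θ - θ'‖)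
    (hρ : ∀ i, ‖q i • gradient (l i) θ‖ ≤ ρ) (hη : 0 ≤ η) (hηΛ : η * Λ ≤ 1)
    (ξ : ℕ → Fin b → Fin N) (j : ℕ) :
    ‖localSGD l q η ξ θ j - θ‖ ≤ η * ρ * (2 ^ j - 1) := by
  induction j with
  | zero => simp [localSGD]
  | succ j ih =>
    set x := localSGD l q η ξ θ j with hx
    have h1 : ‖batchGrad l q (ξ j) x‖ ≤ ρ + Λ * ‖x - θ‖ :=
      calc ‖batchGrad l q (ξ j) x‖
          = ‖batchGrad l q (ξ j) θ + (batchGrad l q (ξ j) x - batchGrad l q (ξ j) θ)‖ := by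
            rw [add_sub_cancel]
        _ ≤ ρ + Λ * ‖x - θ‖ := (norm_add_le _ _).trans (add_le_add
            (norm_batch_average_le hb fun r => hρ _) (norm_batchGrad_sub_le hb hq hl _ _ _))
    calc ‖localSGD l q η ξ θ (j + 1) - θ‖
        = ‖(x - θ) - η • batchGrad l q (ξ j) x‖ := by rw [localSGD, ← hx]; congr 1; abel
      _ ≤ ‖x - θ‖ + η * (ρ + Λ * ‖x - θ‖) := by
        refine (norm_sub_le _ _).trans ?_
        rw [norm_smul, Real.norm_eq_abs, abs_of_nonneg hη]
        gcongr
      _ = (1 + η * Λ) * ‖x - θ‖ + η * ρ := by ring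
      _ ≤ 2 * (η * ρ * (2 ^ j - 1)) + η * ρ := by
        gcongr
        linarith
      _ = _ := by ring

theorem localSGD_sub_eq (ξ : ℕ → Fin b → Fin N) (j : ℕ) :
    localSGD l q η ξ θ j - θ =
      -(η • ∑ j' ∈ Finset.range j, batchGrad l q (ξ j') (localSGD l q η ξ θ j')) := by
  induction j with
  | zero => simp [localSGD]
  | succ j ih =>
    rw [Finset.sum_range_succ, smul_add, neg_add, ← ih, localSGD]
    abel

/-- Local SGD agrees up to `O(η ^ 2)` with a step that evaluates all batch gradients at the starting
point. -/
theorem norm_localSGD_sub_add_le (hb : 0 < b) (hq : ∀ i, |q i| ≤ 1) (hΛ : 0 ≤ Λ)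
    (hl : ∀ i θ θ', ‖gradient (l i) θ - gradient (l i) θ'‖ ≤ Λ * ‖θ - θ'‖)
    (hρ0 : 0 ≤ ρ) (hρ : ∀ i, ‖q i • gradient (l i) θ‖ ≤ ρ) (hη : 0 ≤ η) (hηΛ : η * Λ ≤ 1)
    (ξ : ℕ → Fin b → Fin N) (J : ℕ) :
    ‖localSGD l q η ξ θ J - θ + η • ∑ j ∈ Finset.range J, batchGrad l q (ξ j) θ‖ ≤
      η ^ 2 * (J * Λ * 2 ^ J) * ρ := by
  rw [localSGD_sub_eq, neg_add_eq_sub, ← smul_sub, ← Finset.sum_sub_distrib, norm_smul,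
    Real.norm_eq_abs, abs_of_nonneg hη]
  have h : ∀ j ∈ Finset.range J,
      ‖batchGrad l q (ξ j) θ - batchGrad l q (ξ j) (localSGD l q η ξ θ j)‖ ≤
        Λ * (η * ρ * 2 ^ J) := by
    intro j hj
    refine (norm_batchGrad_sub_le hb hq hl _ _ _).trans ?_
    rw [norm_sub_rev]
    gcongr
    refine (norm_localSGD_sub_le hb hq hl hρ hη hηΛ ξ j).trans ?_
    gcongr
    have : (2 : ℝ) ^ j ≤ 2 ^ J := pow_le_pow_right₀ one_le_two (Finset.mem_range.1 hj).le
    linarith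
  calc _ ≤ η * ∑ j ∈ Finset.range J, Λ * (η * ρ * 2 ^ J) := by
        gcongr
        exact norm_sum_le_of_le _ h
    _ = _ := by rw [Finset.sum_const, Finset.card_range, nsmul_eq_mul]; ring

end LocalSGD

/-! ### One communication round -/

section Round

variable {T M d : ℕ} {n B : Fin T → ℕ}

/-- The parameters after one communication round from `(Θ, W)` with the batches `ξ j t m`. -/
noncomputable def paramStep (l : (t : Fin T) → Fin (n t) → Theta d → ℝ) (J : ℕ) (η : ℝ)
    (ξ : ℕ → (t : Fin T) → Fin M → Fin (B t) → Fin (n t)) (Θ : Params M d)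
    (W : Fin T → Fin M → ℝ) : Params M d :=
  WithLp.toLp 2 fun m => ∑ t, ((n t : ℝ) / ((∑ t', n t' : ℕ) : ℝ)) •
    localSGD (l t) (fun i => eStep l Θ W t i m) η (fun j => ξ j t m) (Θ m) J

variable {l : (t : Fin T) → Fin (n t) → Theta d → ℝ} {Λ ρ η : ℝ} {Θ : Params M d}
  {W : Fin T → Fin M → ℝ}

theorem sum_clientWeight_eq_one [Nonempty (Fin T)] (hn : ∀ t, 0 < n t) :
    ∑ t, (n t : ℝ) / ((∑ t', n t' : ℕ) : ℝ) = 1 := by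
  rw [← Finset.sum_div, ← Nat.cast_sum]
  exact div_self (sum_pos_of_index hn (Classical.arbitrary _)).ne'

theorem paramStep_sub_apply [Nonempty (Fin T)] (hn : ∀ t, 0 < n t) (J : ℕ)
    (ξ : ℕ → (t : Fin T) → Fin M → Fin (B t) → Fin (n t)) (m : Fin M) :
    (paramStep l J η ξ Θ W - Θ) m = ∑ t, ((n t : ℝ) / ((∑ t', n t' : ℕ) : ℝ)) •
      (localSGD (l t) (fun i => eStep l Θ W t i m) η (fun j => ξ j t m) (Θ m) J - Θ m) := by
  simp only [smul_sub, Finset.sum_sub_distrib, ← Finset.sum_smul, sum_clientWeight_eq_one hn,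
    one_smul]
  rfl

/-- An average over the clients is bounded by any common bound of its terms. -/
theorem norm_client_average_le [Nonempty (Fin T)] (hn : ∀ t, 0 < n t) {v : Fin T → Theta d}
    {c : ℝ} (h : ∀ t, ‖v t‖ ≤ c) :
    ‖∑ t, ((n t : ℝ) / ((∑ t', n t' : ℕ) : ℝ)) • v t‖ ≤ c := by
  calc _ ≤ ∑ t, ((n t : ℝ) / ((∑ t', n t' : ℕ) : ℝ)) * c := by
        refine norm_sum_le_of_le _ fun t _ => ?_
        rw [norm_smul, Real.norm_eq_abs, abs_of_nonneg (by positivity)]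
        exact mul_le_mul_of_nonneg_left (h t) (by positivity)
    _ = c := by rw [← Finset.sum_mul, sum_clientWeight_eq_one hn, one_mul]

theorem abs_eStep_le_one (hW : ∀ t, W t ∈ stdSimplex ℝ (Fin M)) (t : Fin T) (i : Fin (n t))
    (m : Fin M) : |eStep l Θ W t i m| ≤ 1 := by
  rw [abs_of_nonneg ((eStep_mem_stdSimplex l Θ hW t i).1 m)]
  exact eStep_le_one hW t i m

theorem norm_paramStep_sub_sq_le [Nonempty (Fin T)] (hl : RegularLosses l Λ)
    (hn : ∀ t, 0 < n t) (hB : ∀ t, 0 < B t) (hW : ∀ t, W t ∈ stdSimplex ℝ (Fin M))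
    (hρ0 : 0 ≤ ρ) (hρ : ∀ t i m, ‖eStep l Θ W t i m • gradient (l t i) (Θ m)‖ ≤ ρ)
    (hη : 0 ≤ η) (hηΛ : η * Λ ≤ 1) (J : ℕ)
    (ξ : ℕ → (t : Fin T) → Fin M → Fin (B t) → Fin (n t)) :
    ‖paramStep l J η ξ Θ W - Θ‖ ^ 2 ≤ η ^ 2 * (M * (2 ^ J) ^ 2) * ρ ^ 2 := by
  rw [PiLp.norm_sq_eq_of_L2]
  have h : ∀ m, ‖(paramStep l J η ξ Θ W - Θ) m‖ ^ 2 ≤ (η * ρ * 2 ^ J) ^ 2 := by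
    intro m
    gcongr
    rw [paramStep_sub_apply hn]
    refine norm_client_average_le hn fun t => ?_
    refine (norm_localSGD_sub_le (hB t) (fun i => abs_eStep_le_one hW t i m) (hl.lip t)
      (fun i => hρ t i m) hη hηΛ _ J).trans ?_
    gcongr
    linarith
  refine (Finset.sum_le_sum fun m _ => h m).trans (le_of_eq ?_)
  rw [Finset.sum_const, Finset.card_univ, Fintype.card_fin, nsmul_eq_mul]
  ring

/-- The pairing of a direction `A` with the sum of the batch gradients that the clients use in a
round, all evaluated at the starting point of the round. -/
noncomputable def batchPairing (l : (t : Fin T) → Fin (n t) → Theta d → ℝ) (J : ℕ)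
    (ξ : ℕ → (t : Fin T) → Fin M → Fin (B t) → Fin (n t)) (Θ : Params M d)
    (W : Fin T → Fin M → ℝ) (A : Params M d) : ℝ :=
  ∑ m, ∑ t, ((n t : ℝ) / ((∑ t', n t' : ℕ) : ℝ)) * ∑ j ∈ Finset.range J, (1 / (B t : ℝ)) *
    ∑ r, inner ℝ (A m) (eStep l Θ W t (ξ j t m r) m • gradient (l t (ξ j t m r)) (Θ m))

theorem inner_paramStep_sub_le [Nonempty (Fin T)] (hl : RegularLosses l Λ)
    (hn : ∀ t, 0 < n t) (hB : ∀ t, 0 < B t) (hW : ∀ t, W t ∈ stdSimplex ℝ (Fin M))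
    (hρ0 : 0 ≤ ρ) (hρ : ∀ t i m, ‖eStep l Θ W t i m • gradient (l t i) (Θ m)‖ ≤ ρ)
    (hη : 0 ≤ η) (hηΛ : η * Λ ≤ 1) (J : ℕ)
    (ξ : ℕ → (t : Fin T) → Fin M → Fin (B t) → Fin (n t)) {A : Params M d}
    (hA : ∀ m, ‖A m‖ ≤ ρ) :
    inner ℝ A (paramStep l J η ξ Θ W - Θ) ≤
      -(η * batchPairing l J ξ Θ W A) + η ^ 2 * (M * (J * Λ * 2 ^ J)) * ρ ^ 2 := by
  rw [PiLp.inner_apply]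
  have h : ∀ m, inner ℝ (A m) ((paramStep l J η ξ Θ W - Θ) m) ≤
      -(η * ∑ t, ((n t : ℝ) / ((∑ t', n t' : ℕ) : ℝ)) * ∑ j ∈ Finset.range J, (1 / (B t : ℝ)) *
        ∑ r, inner ℝ (A m)
          (eStep l Θ W t (ξ j t m r) m • gradient (l t (ξ j t m r)) (Θ m))) +
      η ^ 2 * (J * Λ * 2 ^ J) * ρ ^ 2 := by
    intro m
    set V : Theta d := ∑ t, ((n t : ℝ) / ((∑ t', n t' : ℕ) : ℝ)) • ∑ j ∈ Finset.range J,
      batchGrad (l t) (fun i => eStep l Θ W t i m) (ξ j t m) (Θ m) with hV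
    have h1 : ‖(paramStep l J η ξ Θ W - Θ) m + η • V‖ ≤ η ^ 2 * (J * Λ * 2 ^ J) * ρ := by
      rw [paramStep_sub_apply hn, hV, Finset.smul_sum, ← Finset.sum_add_distrib]
      simp only [smul_comm η, ← smul_add]
      exact norm_client_average_le hn fun t => norm_localSGD_sub_add_le (hB t)
        (fun i => abs_eStep_le_one hW t i m) hl.pos.le (hl.lip t) hρ0 (fun i => hρ t i m) hη hηΛ
        _ J
    have h2 : inner ℝ (A m) V = ∑ t, ((n t : ℝ) / ((∑ t', n t' : ℕ) : ℝ)) *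
        ∑ j ∈ Finset.range J, (1 / (B t : ℝ)) * ∑ r, inner ℝ (A m)
          (eStep l Θ W t (ξ j t m r) m • gradient (l t (ξ j t m r)) (Θ m)) := by
      simp only [hV, batchGrad, inner_sum, real_inner_smul_right]
    have h3 : inner ℝ (A m) ((paramStep l J η ξ Θ W - Θ) m + η • V) ≤
        ρ * (η ^ 2 * (J * Λ * 2 ^ J) * ρ) :=
      (real_inner_le_norm _ _).trans (mul_le_mul (hA m) h1 (norm_nonneg _) hρ0)
    rw [inner_add_right, real_inner_smul_right, h2] at h3
    linarith
  refine (Finset.sum_le_sum fun m _ => h m).trans (le_of_eq ?_)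
  rw [Finset.sum_add_distrib, Finset.sum_neg_distrib, ← Finset.mul_sum, Finset.sum_const,
    Finset.card_univ, Fintype.card_fin, nsmul_eq_mul, batchPairing]
  ring

/-- The constant of the second-order terms in the descent of one round. -/
noncomputable def roundConst (n : Fin T → ℕ) (M J : ℕ) (Λ : ℝ) : ℝ :=
  (M * (J * Λ * 2 ^ J) + Λ * (M * (2 ^ J) ^ 2)) * (4 * Λ * ((∑ t, n t : ℕ) : ℝ))

theorem roundConst_nonneg (n : Fin T → ℕ) (M J : ℕ) (hΛ : 0 ≤ Λ) : 0 ≤ roundConst n M J Λ := by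
  unfold roundConst; positivity

/-- Descent of one round with random batches, before taking expectations. The gradient is taken at
weights `V`, and the value after the round at weights `V'`; these may differ from the weights `W`
that drive the round. -/
theorem negLogLik_paramStep_le [Nonempty (Fin T)] (hl : RegularLosses l Λ)
    (hn : ∀ t, 0 < n t) (hB : ∀ t, 0 < B t) (hW : ∀ t, W t ∈ stdSimplex ℝ (Fin M))
    {V V' : Fin T → Fin M → ℝ} (hV : ∀ t, V t ∈ stdSimplex ℝ (Fin M))
    (hV' : ∀ t, V' t ∈ stdSimplex ℝ (Fin M)) (hac : ∀ t m, 0 < V t m → 0 < V' t m)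
    (hlog : ∀ t, 0 ≤ ∑ i, ∑ m, eStep l Θ V t i m * Real.log (V' t m / V t m))
    (hVW : negLogLik l Θ V ≤ negLogLik l Θ W)
    (hη : 0 ≤ η) (hηΛ : η * Λ ≤ 1) (J : ℕ)
    (ξ : ℕ → (t : Fin T) → Fin M → Fin (B t) → Fin (n t)) :
    negLogLik l (paramStep l J η ξ Θ W) V' ≤ negLogLik l Θ V -
      η * batchPairing l J ξ Θ W (mixGrad l Θ V) +
      η ^ 2 * roundConst n M J Λ * negLogLik l Θ W := by
  have hΛ := hl.pos
  have hF := negLogLik_nonneg (Θ := Θ) hl hW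
  set ρ := √(4 * Λ * ((∑ t, n t : ℕ) : ℝ) * negLogLik l Θ W) with hρdef
  have hρ0 : 0 ≤ ρ := Real.sqrt_nonneg _
  have hρsq : ρ ^ 2 = 4 * Λ * ((∑ t, n t : ℕ) : ℝ) * negLogLik l Θ W :=
    Real.sq_sqrt (by positivity)
  have hρW : ∀ t i m, ‖eStep l Θ W t i m • gradient (l t i) (Θ m)‖ ≤ ρ := fun t i m =>
    Real.le_sqrt_of_sq_le (norm_eStep_smul_gradient_sq_le hl hn hW t i m)
  have hρV : ∀ m, ‖mixGrad l Θ V m‖ ≤ ρ := fun m =>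
    norm_mixGrad_row_le hn hρ0 m fun t i =>
      Real.le_sqrt_of_sq_le ((norm_eStep_smul_gradient_sq_le hl hn hV t i m).trans
        (by gcongr))
  have h1 := negLogLik_le_add_inner (Θ' := paramStep l J η ξ Θ W) hl hV hV' hac hlog
  have h2 := inner_paramStep_sub_le hl hn hB hW hρ0 hρW hη hηΛ J ξ hρV
  have h3 := mul_le_mul_of_nonneg_left
    (norm_paramStep_sub_sq_le hl hn hB hW hρ0 hρW hη hηΛ J ξ) hΛ.le
  rw [hρsq] at h2 h3
  have h4 : η ^ 2 * roundConst n M J Λ * negLogLik l Θ W =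
      η ^ 2 * (M * (J * Λ * 2 ^ J)) * (4 * Λ * ((∑ t, n t : ℕ) : ℝ) * negLogLik l Θ W) +
      Λ * (η ^ 2 * (M * (2 ^ J) ^ 2) * (4 * Λ * ((∑ t, n t : ℕ) : ℝ) * negLogLik l Θ W)) := by
    rw [roundConst]; ring
  linarith

/-- A bound for the pairing of the gradients at two choices of weights, in a form that is linear in
the objective and in the square of one gradient. -/
theorem neg_inner_mixGrad_le (hl : RegularLosses l Λ) (hn : ∀ t, 0 < n t)
    {V : Fin T → Fin M → ℝ} (hV : ∀ t, V t ∈ stdSimplex ℝ (Fin M))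
    (hVW : negLogLik l Θ V ≤ negLogLik l Θ W) {s : ℝ} (hs : 0 < s) :
    -inner ℝ (mixGrad l Θ V) (mixGrad l Θ W) ≤
      M * (4 * Λ * ((∑ t, n t : ℕ) : ℝ)) * negLogLik l Θ W / s + s * ‖mixGrad l Θ W‖ ^ 2 := by
  have hΛ := hl.pos
  have hF := (negLogLik_nonneg (Θ := Θ) hl hV).trans hVW
  have hρ : ‖mixGrad l Θ V‖ ^ 2 ≤
      M * (4 * Λ * ((∑ t, n t : ℕ) : ℝ)) * negLogLik l Θ W := by
    rw [PiLp.norm_sq_eq_of_L2]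
    have h : ∀ m, ‖mixGrad l Θ V m‖ ^ 2 ≤
        4 * Λ * ((∑ t, n t : ℕ) : ℝ) * negLogLik l Θ W := fun m => by
      refine (Real.le_sqrt (norm_nonneg _) (by positivity)).1
        (norm_mixGrad_row_le hn (Real.sqrt_nonneg _) m fun t i => ?_)
      exact Real.le_sqrt_of_sq_le ((norm_eStep_smul_gradient_sq_le hl hn hV t i m).trans
        (by gcongr))
    refine (Finset.sum_le_sum fun m _ => h m).trans (le_of_eq ?_)
    rw [Finset.sum_const, Finset.card_univ, Fintype.card_fin, nsmul_eq_mul]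
    ring
  set a := ‖mixGrad l Θ V‖
  set g := ‖mixGrad l Θ W‖
  have h1 : -inner ℝ (mixGrad l Θ V) (mixGrad l Θ W) ≤ a * g := by
    rw [← inner_neg_left]
    exact (real_inner_le_norm _ _).trans (by rw [norm_neg])
  have h2 : a * g ≤ a ^ 2 / s + s * g ^ 2 := by
    have h3 : a ^ 2 / s + s * g ^ 2 - a * g = ((a - s * g) ^ 2 + s * (a * g)) / s := by
      field_simp; ring
    have : 0 ≤ ((a - s * g) ^ 2 + s * (a * g)) / s := by positivity
    linarith
  refine h1.trans (h2.trans ?_)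
  gcongr

end Round

/-! ### Randomness of a run -/

section Sampling

variable {T M d : ℕ} {n B : Fin T → ℕ} {Ω : Type*} [MeasurableSpace Ω] {P : Measure Ω}
  {ν : (t : Fin T) → Measure (Fin (B t) → Fin (n t))}
  {ξ : ℕ → ℕ → (t : Fin T) → Ω → Fin M → Fin (B t) → Fin (n t)}

theorem iterates_succ (l : (t : Fin T) → Fin (n t) → Theta d → ℝ) (J : ℕ) (η : ℝ)
    (ξ : ℕ → ℕ → (t : Fin T) → Fin M → Fin (B t) → Fin (n t)) (Θ₀ : Params M d)
    (W₀ : Fin T → Fin M → ℝ) (k : ℕ) :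
    iterates l J η ξ Θ₀ W₀ (k + 1) =
      (paramStep l J η (ξ k) (iterates l J η ξ Θ₀ W₀ k).1 (iterates l J η ξ Θ₀ W₀ k).2,
        weightStep l (iterates l J η ξ Θ₀ W₀ k).1 (iterates l J η ξ Θ₀ W₀ k).2) := rfl

theorem iterates_weights_mem {l : (t : Fin T) → Fin (n t) → Theta d → ℝ} (hn : ∀ t, 0 < n t)
    (J : ℕ) (η : ℝ)
    (ξ : ℕ → ℕ → (t : Fin T) → Fin M → Fin (B t) → Fin (n t)) (Θ₀ : Params M d)
    {W₀ : Fin T → Fin M → ℝ} (hW₀ : ∀ t, W₀ t ∈ stdSimplex ℝ (Fin M)) (k : ℕ) (t : Fin T) :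
    (iterates l J η ξ Θ₀ W₀ k).2 t ∈ stdSimplex ℝ (Fin M) := by
  induction k generalizing t with
  | zero => exact hW₀ t
  | succ k ih => exact weightStep_mem_stdSimplex l _ hn ih t

theorem localSGD_congr {N b : ℕ} {l : Fin N → Theta d → ℝ} {q : Fin N → ℝ} {η : ℝ}
    {ξ ξ' : ℕ → Fin b → Fin N} {θ : Theta d} {J : ℕ} (h : ∀ j < J, ξ j = ξ' j) :
    localSGD l q η ξ θ J = localSGD l q η ξ' θ J := by
  induction J with
  | zero => rfl
  | succ J ih =>
    rw [localSGD, localSGD, ih fun j hj => h j (by omega), h J (by omega)]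

theorem iterates_congr {l : (t : Fin T) → Fin (n t) → Theta d → ℝ} {J : ℕ} {η : ℝ}
    {ξ ξ' : ℕ → ℕ → (t : Fin T) → Fin M → Fin (B t) → Fin (n t)} {Θ₀ : Params M d}
    {W₀ : Fin T → Fin M → ℝ} {k : ℕ} (h : ∀ k' < k, ∀ j < J, ∀ t, ξ k' j t = ξ' k' j t) :
    iterates l J η ξ Θ₀ W₀ k = iterates l J η ξ' Θ₀ W₀ k := by
  induction k with
  | zero => rfl
  | succ k ih =>
    rw [iterates_succ, iterates_succ, ih fun k' hk' => h k' (by omega)]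
    congr 1
    simp only [paramStep]
    congr 1
    funext m
    refine Finset.sum_congr rfl fun t _ => ?_
    rw [localSGD_congr fun j hj => congrFun (h k (by omega) j hj t) m]

/-- The indices of the draws made in the first `k` rounds. -/
def pastIndices (T J k : ℕ) : Finset (ℕ × ℕ × Fin T) :=
  Finset.range k ×ˢ Finset.range J ×ˢ Finset.univ

/-- The batches drawn in the first `k` rounds. This variable takes finitely many values. -/
def past {Ω : Type*} (J k : ℕ) (ξ : ℕ → ℕ → (t : Fin T) → Ω → Fin M → Fin (B t) → Fin (n t)) (ω : Ω)
    (a : pastIndices T J k) : Fin M → Fin (B a.1.2.2) → Fin (n a.1.2.2) :=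
  ξ a.1.1 a.1.2.1 a.1.2.2 ω

theorem measurable_past (hξ : IsBatchSampling P ν ξ) (J k : ℕ) : Measurable (past J k ξ) :=
  measurable_pi_lambda _ fun _ => hξ.measurable _ _ _

/-- The state after `k` rounds is a function of the batches of the first `k` rounds. -/
theorem exists_iterates_eq_past {Ω : Type*} (l : (t : Fin T) → Fin (n t) → Theta d → ℝ) (J : ℕ) (η : ℝ)
    (ξ : ℕ → ℕ → (t : Fin T) → Ω → Fin M → Fin (B t) → Fin (n t)) (Θ₀ : Params M d)
    (W₀ : Fin T → Fin M → ℝ) (k : ℕ) :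
    ∃ Ψ : ((a : pastIndices T J k) → Fin M → Fin (B a.1.2.2) → Fin (n a.1.2.2)) →
        Params M d × (Fin T → Fin M → ℝ),
      ∀ ω, iterates l J η (fun k j t => ξ k j t ω) Θ₀ W₀ k = Ψ (past J k ξ ω) := by
  have h : Function.FactorsThrough
      (fun ω => iterates l J η (fun k j t => ξ k j t ω) Θ₀ W₀ k) (past J k ξ) := by
    intro ω ω' hω
    refine iterates_congr fun k' hk' j hj t => ?_
    exact congrFun hω ⟨(k', j, t), by simp [pastIndices, hk', hj]⟩
  obtain ⟨Ψ, hΨ⟩ := (Function.factorsThrough_iff _).1 h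
  exact ⟨Ψ, congrFun hΨ⟩

theorem integrable_past [IsProbabilityMeasure P] (hξ : IsBatchSampling P ν ξ) (J k : ℕ)
    (Φ : ((a : pastIndices T J k) → Fin M → Fin (B a.1.2.2) → Fin (n a.1.2.2)) → ℝ) :
    Integrable (fun ω => Φ (past J k ξ ω)) P := by
  have hm := measurable_past hξ J k
  have := Measure.isProbabilityMeasure_map (μ := P) hm.aemeasurable
  exact (Integrable.of_finite (f := Φ)).comp_measurable hm

/-- Every real function of the state after `k` rounds is integrable. -/
theorem integrable_iterates [IsProbabilityMeasure P] (hξ : IsBatchSampling P ν ξ)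
    (l : (t : Fin T) → Fin (n t) → Theta d → ℝ) (J : ℕ) (η : ℝ) (Θ₀ : Params M d)
    (W₀ : Fin T → Fin M → ℝ) (k : ℕ) (φ : Params M d × (Fin T → Fin M → ℝ) → ℝ) :
    Integrable (fun ω => φ (iterates l J η (fun k j t => ξ k j t ω) Θ₀ W₀ k)) P := by
  obtain ⟨Ψ, hΨ⟩ := exists_iterates_eq_past l J η ξ Θ₀ W₀ k
  simp only [hΨ]
  exact integrable_past hξ J k fun u => φ (Ψ u)

/-- The batches of one step of round `k + 1` are independent of the first `k` rounds. -/
theorem indepFun_past (hξ : IsBatchSampling P ν ξ) (J k j : ℕ) (t : Fin T) :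
    IndepFun (past J k ξ) (ξ k j t) P := by
  have h := hξ.indep.indepFun_finset (pastIndices T J k) {(k, j, t)}
    (by simp [pastIndices]) fun a => hξ.measurable _ _ _
  exact h.comp measurable_id (measurable_pi_apply
    (⟨(k, j, t), Finset.mem_singleton_self _⟩ : ({(k, j, t)} : Finset (ℕ × ℕ × Fin T))))

theorem measureReal_batch_eq (hξ : IsBatchSampling P ν ξ) (hν : UniformBatches ν) (k j : ℕ)
    (t : Fin T) (m : Fin M) (r : Fin (B t)) (i : Fin (n t)) :
    P.real {ω | ξ k j t ω m r = i} = 1 / (n t : ℝ) := by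
  have hm : Measurable fun ω => ξ k j t ω m := (measurable_pi_apply m).comp (hξ.measurable k j t)
  have h := hν t r i
  rw [← hξ.law k j t m, Measure.map_apply hm (MeasurableSet.of_discrete)] at h
  rw [Measure.real]
  change (P {ω | ξ k j t ω m r = i}).toReal = _
  change P {ω | ξ k j t ω m r = i} = _ at h
  rw [h]
  simp

/-- Averaging over one fresh uniform index replaces it by the average over the whole dataset. -/
theorem integral_fresh_index [IsProbabilityMeasure P] (hξ : IsBatchSampling P ν ξ)
    (hν : UniformBatches ν) (l : (t : Fin T) → Fin (n t) → Theta d → ℝ) (J : ℕ) (η : ℝ)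
    (Θ₀ : Params M d) (W₀ : Fin T → Fin M → ℝ) (k j : ℕ) (t : Fin T) (m : Fin M) (r : Fin (B t))
    (φ : Fin (n t) → Params M d × (Fin T → Fin M → ℝ) → ℝ) :
    Integrable (fun ω => φ (ξ k j t ω m r)
      (iterates l J η (fun k j t => ξ k j t ω) Θ₀ W₀ k)) P ∧
    ∫ ω, φ (ξ k j t ω m r) (iterates l J η (fun k j t => ξ k j t ω) Θ₀ W₀ k) ∂P =
      (1 / (n t : ℝ)) *
        ∑ i, ∫ ω, φ i (iterates l J η (fun k j t => ξ k j t ω) Θ₀ W₀ k) ∂P := by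
  obtain ⟨Ψ, hΨ⟩ := exists_iterates_eq_past l J η ξ Θ₀ W₀ k
  simp only [hΨ]
  have hmeas : ∀ i, MeasurableSet {ω | ξ k j t ω m r = i} := fun i =>
    (measurable_pi_apply r).comp ((measurable_pi_apply m).comp (hξ.measurable k j t))
      (measurableSet_singleton i)
  set χ : Fin (n t) → Ω → ℝ := fun i => Set.indicator {ω | ξ k j t ω m r = i} 1 with hχ
  have hsplit : ∀ ω, φ (ξ k j t ω m r) (Ψ (past J k ξ ω)) =
      ∑ i, φ i (Ψ (past J k ξ ω)) * χ i ω := by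
    intro ω
    rw [Finset.sum_eq_single (ξ k j t ω m r)]
    · simp [hχ]
    · intro i _ hi
      simp [hχ, hi.symm]
    · simp
  have hint : ∀ i, Integrable (fun ω => φ i (Ψ (past J k ξ ω)) * χ i ω) P := by
    intro i
    have h := (integrable_past hξ J k fun u => φ i (Ψ u)).indicator (hmeas i)
    refine h.congr (Filter.Eventually.of_forall fun ω => ?_)
    by_cases hω : ξ k j t ω m r = i <;> simp [hχ, hω]
  have hval : ∀ i, ∫ ω, φ i (Ψ (past J k ξ ω)) * χ i ω ∂P =
      (1 / (n t : ℝ)) * ∫ ω, φ i (Ψ (past J k ξ ω)) ∂P := by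
    intro i
    have hind : IndepFun (fun ω => φ i (Ψ (past J k ξ ω))) (χ i) P := by
      have h := (indepFun_past hξ J k j t).comp (φ := fun u => φ i (Ψ u))
        (ψ := fun v => Set.indicator {v : Fin M → Fin (B t) → Fin (n t) | v m r = i}
          (fun _ => (1 : ℝ)) v) (measurable_of_countable _) (measurable_of_countable _)
      exact h
    rw [hind.integral_fun_mul_eq_mul_integral
      (integrable_past hξ J k fun u => φ i (Ψ u)).aestronglyMeasurable
      ((measurable_one.indicator (hmeas i)).aestronglyMeasurable), hχ,
      integral_indicator_one (hmeas i), measureReal_batch_eq hξ hν, mul_comm]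
  simp only [hsplit]
  refine ⟨integrable_finsetSum _ fun i _ => hint i, ?_⟩
  rw [integral_finsetSum _ fun i _ => hint i, Finset.mul_sum]
  exact Finset.sum_congr rfl fun i _ => hval i

/-- In expectation, the batch gradients of a round pair with a direction that depends on the past
like `J` times the full gradient. -/
theorem integral_batchPairing [IsProbabilityMeasure P] (hξ : IsBatchSampling P ν ξ)
    (hν : UniformBatches ν) (hn : ∀ t, 0 < n t) (hB : ∀ t, 0 < B t)
    (l : (t : Fin T) → Fin (n t) → Theta d → ℝ) (J : ℕ) (η : ℝ)
    (Θ₀ : Params M d) (W₀ : Fin T → Fin M → ℝ) (k : ℕ)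
    (A : Params M d × (Fin T → Fin M → ℝ) → Params M d) :
    let st := fun ω => iterates l J η (fun k j t => ξ k j t ω) Θ₀ W₀ k
    Integrable (fun ω =>
      batchPairing l J (fun j t => ξ k j t ω) (st ω).1 (st ω).2 (A (st ω))) P ∧
    ∫ ω, batchPairing l J (fun j t => ξ k j t ω) (st ω).1 (st ω).2 (A (st ω)) ∂P =
      J * ∫ ω, inner ℝ (A (st ω)) (mixGrad l (st ω).1 (st ω).2) ∂P := by
  intro st
  have hterm := fun (j : ℕ) (t : Fin T) (m : Fin M) (r : Fin (B t)) =>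
    integral_fresh_index hξ hν l J η Θ₀ W₀ k j t m r
      fun i s => inner ℝ (A s m) (eStep l s.1 s.2 t i m • gradient (l t i) (s.1 m))
  have hi1 : ∀ j t m, Integrable (fun ω => (1 / (B t : ℝ)) * ∑ r, inner ℝ (A (st ω) m)
      (eStep l (st ω).1 (st ω).2 t (ξ k j t ω m r) m •
        gradient (l t (ξ k j t ω m r)) ((st ω).1 m))) P := fun j t m =>
    (integrable_finsetSum _ fun r _ => (hterm j t m r).1).const_mul _
  have hi2 := fun (t : Fin T) (m : Fin M) =>
    (integrable_finsetSum (Finset.range J) fun j _ => hi1 j t m).const_mul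
      ((n t : ℝ) / ((∑ t', n t' : ℕ) : ℝ))
  have hi3 := fun (m : Fin M) => integrable_finsetSum Finset.univ fun t _ => hi2 t m
  refine ⟨integrable_finsetSum Finset.univ fun m _ => hi3 m, ?_⟩
  have hφ : ∀ (φ : Params M d × (Fin T → Fin M → ℝ) → ℝ), Integrable (fun ω => φ (st ω)) P :=
    fun φ => integrable_iterates hξ l J η Θ₀ W₀ k φ
  have hR : ∀ ω, inner ℝ (A (st ω)) (mixGrad l (st ω).1 (st ω).2) =
      ∑ m, ∑ t, ∑ i, (1 / ((∑ t, n t : ℕ) : ℝ)) *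
        inner ℝ (A (st ω) m) (eStep l (st ω).1 (st ω).2 t i m • gradient (l t i) ((st ω).1 m)) := by
    intro ω
    rw [PiLp.inner_apply]
    simp only [mixGrad_apply, inner_sum, real_inner_smul_right, Finset.mul_sum]
  simp only [hR, batchPairing]
  rw [integral_finsetSum _ fun m _ => hi3 m, integral_finsetSum _ fun m _ =>
    hφ fun s => ∑ t, ∑ i, (1 / ((∑ t, n t : ℕ) : ℝ)) *
      inner ℝ (A s m) (eStep l s.1 s.2 t i m • gradient (l t i) (s.1 m)), Finset.mul_sum]
  refine Finset.sum_congr rfl fun m _ => ?_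
  rw [integral_finsetSum _ fun t _ => hi2 t m, integral_finsetSum _ fun t _ =>
    hφ fun s => ∑ i, (1 / ((∑ t, n t : ℕ) : ℝ)) *
      inner ℝ (A s m) (eStep l s.1 s.2 t i m • gradient (l t i) (s.1 m)), Finset.mul_sum]
  refine Finset.sum_congr rfl fun t _ => ?_
  have hn' : (n t : ℝ) ≠ 0 := by exact_mod_cast (hn t).ne'
  have hB' : (B t : ℝ) ≠ 0 := by exact_mod_cast (hB t).ne'
  have hj : ∀ j, ∫ ω, (1 / (B t : ℝ)) * ∑ r, inner ℝ (A (st ω) m)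
      (eStep l (st ω).1 (st ω).2 t (ξ k j t ω m r) m •
        gradient (l t (ξ k j t ω m r)) ((st ω).1 m)) ∂P =
      (1 / (n t : ℝ)) * ∑ i, ∫ ω, inner ℝ (A (st ω) m)
        (eStep l (st ω).1 (st ω).2 t i m • gradient (l t i) ((st ω).1 m)) ∂P := by
    intro j
    rw [integral_const_mul, integral_finsetSum _ fun r _ => (hterm j t m r).1,
      Finset.sum_congr rfl fun r _ => (hterm j t m r).2, Finset.sum_const, Finset.card_univ,
      Fintype.card_fin, nsmul_eq_mul, ← mul_assoc, one_div_mul_cancel hB', one_mul]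
  rw [integral_const_mul, integral_finsetSum _ fun j _ => hi1 j t m,
    Finset.sum_congr rfl fun j _ => hj j, Finset.sum_const, Finset.card_range, nsmul_eq_mul,
    integral_finsetSum _ fun i _ => hφ fun s => (1 / ((∑ t, n t : ℕ) : ℝ)) *
      inner ℝ (A s m) (eStep l s.1 s.2 t i m • gradient (l t i) (s.1 m))]
  simp only [integral_const_mul]
  rw [← Finset.mul_sum]
  field_simp

end Sampling

/-! ### Expected descent -/

section Expectation

variable {T M d : ℕ} {n B : Fin T → ℕ} {Ω : Type*} [MeasurableSpace Ω] {P : Measure Ω}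
  {ν : (t : Fin T) → Measure (Fin (B t) → Fin (n t))}
  {ξ : ℕ → ℕ → (t : Fin T) → Ω → Fin M → Fin (B t) → Fin (n t)}
  {l : (t : Fin T) → Fin (n t) → Theta d → ℝ} {Λ η : ℝ}
  {Θ₀ : Params M d} {W₀ : Fin T → Fin M → ℝ}

/-- The expected objective decreases by the expected squared gradient, up to a second-order term
that is proportional to the objective itself. -/
theorem integral_negLogLik_succ_le [Nonempty (Fin T)] [IsProbabilityMeasure P]
    (hl : RegularLosses l Λ) (hξ : IsBatchSampling P ν ξ)
    (hν : UniformBatches ν) (hn : ∀ t, 0 < n t) (hB : ∀ t, 0 < B t)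
    (hW₀ : ∀ t, W₀ t ∈ stdSimplex ℝ (Fin M)) (J : ℕ) (hη : 0 ≤ η) (hηΛ : η * Λ ≤ 1) (k : ℕ) :
    let st := fun k ω => iterates l J η (fun k j t => ξ k j t ω) Θ₀ W₀ k
    ∫ ω, negLogLik l (st (k + 1) ω).1 (st (k + 1) ω).2 ∂P ≤
      (1 + η ^ 2 * roundConst n M J Λ) * ∫ ω, negLogLik l (st k ω).1 (st k ω).2 ∂P -
        η * J * ∫ ω, ‖mixGrad l (st k ω).1 (st k ω).2‖ ^ 2 ∂P := by
  intro st
  have hW : ∀ ω t, (st k ω).2 t ∈ stdSimplex ℝ (Fin M) := fun ω =>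
    iterates_weights_mem hn J η _ Θ₀ hW₀ k
  obtain ⟨hi, he⟩ := integral_batchPairing hξ hν hn hB l J η Θ₀ W₀ k fun s => mixGrad l s.1 s.2
  have hiF := integrable_iterates hξ l J η Θ₀ W₀ k fun s => negLogLik l s.1 s.2
  have hiF' := integrable_iterates hξ l J η Θ₀ W₀ (k + 1) fun s => negLogLik l s.1 s.2
  have h := integral_mono hiF' ((hiF.sub (hi.const_mul η)).add
    (hiF.const_mul (η ^ 2 * roundConst n M J Λ))) fun ω =>
      negLogLik_paramStep_le hl hn hB (hW ω) (hW ω)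
        (weightStep_mem_stdSimplex l _ hn (hW ω)) (weightStep_pos hn (hW ω))
        (sum_eStep_mul_log_weightStep_nonneg hn (hW ω)) le_rfl hη hηΛ J fun j t => ξ k j t ω
  refine h.trans (le_of_eq ?_)
  rw [integral_add' (hiF.sub (hi.const_mul η)) (hiF.const_mul _),
    integral_sub' hiF (hi.const_mul η), integral_const_mul, integral_const_mul, he]
  simp only [real_inner_self_eq_norm_sq]
  ring

/-- The decrease of the objective through the weights is bounded by the total decrease, since the
parameters move along the gradient at the old weights and can raise the objective at the new weights
only by the pairing of the two gradients. -/
theorem integral_weight_decrease_le [Nonempty (Fin T)] [IsProbabilityMeasure P]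
    (hl : RegularLosses l Λ) (hξ : IsBatchSampling P ν ξ)
    (hν : UniformBatches ν) (hn : ∀ t, 0 < n t) (hB : ∀ t, 0 < B t)
    (hW₀ : ∀ t, W₀ t ∈ stdSimplex ℝ (Fin M)) (J : ℕ) (hη : 0 ≤ η) (hηΛ : η * Λ ≤ 1)
    {s : ℝ} (hs : 0 < s) (k : ℕ) :
    let st := fun k ω => iterates l J η (fun k j t => ξ k j t ω) Θ₀ W₀ k
    ∫ ω, (negLogLik l (st k ω).1 (st k ω).2 - negLogLik l (st k ω).1 (st (k + 1) ω).2) ∂P ≤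
      (1 + η ^ 2 * roundConst n M J Λ) * ∫ ω, negLogLik l (st k ω).1 (st k ω).2 ∂P -
        ∫ ω, negLogLik l (st (k + 1) ω).1 (st (k + 1) ω).2 ∂P +
        η * J * (M * (4 * Λ * ((∑ t, n t : ℕ) : ℝ)) *
          (∫ ω, negLogLik l (st k ω).1 (st k ω).2 ∂P) / s +
          s * ∫ ω, ‖mixGrad l (st k ω).1 (st k ω).2‖ ^ 2 ∂P) := by
  intro st
  have hW : ∀ ω t, (st k ω).2 t ∈ stdSimplex ℝ (Fin M) := fun ω =>
    iterates_weights_mem hn J η _ Θ₀ hW₀ k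
  have hV : ∀ ω t, weightStep l (st k ω).1 (st k ω).2 t ∈ stdSimplex ℝ (Fin M) := fun ω =>
    weightStep_mem_stdSimplex l _ hn (hW ω)
  have hle : ∀ ω, negLogLik l (st k ω).1 (weightStep l (st k ω).1 (st k ω).2) ≤
      negLogLik l (st k ω).1 (st k ω).2 := fun ω => negLogLik_weightStep_le hn (hW ω)
  obtain ⟨hi, he⟩ := integral_batchPairing hξ hν hn hB l J η Θ₀ W₀ k
    fun s => mixGrad l s.1 (weightStep l s.1 s.2)
  have hφ : ∀ (k : ℕ) (φ : Params M d × (Fin T → Fin M → ℝ) → ℝ),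
      Integrable (fun ω => φ (st k ω)) P :=
    fun k φ => integrable_iterates hξ l J η Θ₀ W₀ k φ
  have hiF := hφ k fun s => negLogLik l s.1 s.2
  have hiV := hφ k fun s => negLogLik l s.1 (weightStep l s.1 s.2)
  have hiF' := hφ (k + 1) fun s => negLogLik l s.1 s.2
  have hig := hφ k fun s => ‖mixGrad l s.1 s.2‖ ^ 2
  have hii := hφ k fun s => inner ℝ (mixGrad l s.1 (weightStep l s.1 s.2)) (mixGrad l s.1 s.2)
  have h1 := integral_mono hiF' ((hiV.sub (hi.const_mul η)).add
    (hiF.const_mul (η ^ 2 * roundConst n M J Λ))) fun ω =>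
      negLogLik_paramStep_le hl hn hB (hW ω) (hV ω) (hV ω) (fun _ _ h => h)
        (sum_eStep_mul_log_div_self) (hle ω) hη hηΛ J fun j t => ξ k j t ω
  rw [integral_add' (hiV.sub (hi.const_mul η)) (hiF.const_mul _),
    integral_sub' hiV (hi.const_mul η), integral_const_mul, integral_const_mul, he] at h1
  have h2 := integral_mono hii.neg ((((hiF.const_mul (M * (4 * Λ * ((∑ t, n t : ℕ) : ℝ)))).div_const
    s)).add (hig.const_mul s)) fun ω => neg_inner_mixGrad_le hl hn (hV ω) (hle ω) hs
  rw [integral_neg', integral_add' ((hiF.const_mul _).div_const s) (hig.const_mul s),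
    integral_div, integral_const_mul, integral_const_mul] at h2
  have h3 := mul_le_mul_of_nonneg_left h2 (by positivity : 0 ≤ η * J)
  have h4 : ∫ ω, (negLogLik l (st k ω).1 (st k ω).2 - negLogLik l (st k ω).1 (st (k + 1) ω).2) ∂P =
      ∫ ω, negLogLik l (st k ω).1 (st k ω).2 ∂P -
      ∫ ω, negLogLik l (st k ω).1 (weightStep l (st k ω).1 (st k ω).2) ∂P :=
    integral_sub hiF hiV
  rw [h4]
  linarith

end Expectation

/-! ### Summation of the recursions -/

section Recursion

/-- Rates from the two one-round inequalities with step size `η = a₀ / √K`. The second-order terms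
`c η ^ 2` add up to a constant over `K` rounds, and the choice `s = K ^ (1 / 4)` balances the two
parts of the bound for the weights. -/
theorem rates_of_recursion {c b a₀ F₀ : ℝ} {J K : ℕ} (hc : 0 ≤ c) (hb : 0 ≤ b) (ha₀ : 0 < a₀)
    (hJ : 0 < J) (hK : 0 < K) {F g D : ℕ → ℝ} (hF : ∀ k, 0 ≤ F k) (hg : ∀ k, 0 ≤ g k)
    (hF0 : F 0 = F₀)
    (hrec : ∀ k, F (k + 1) ≤ (1 + (a₀ / √(K : ℝ)) ^ 2 * c) * F k - a₀ / √(K : ℝ) * J * g k)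
    (hD : ∀ s, 0 < s → ∀ k, D k ≤ (1 + (a₀ / √(K : ℝ)) ^ 2 * c) * F k - F (k + 1) +
      a₀ / √(K : ℝ) * J * (b * F k / s + s * g k)) :
    (1 / (K : ℝ)) * ∑ k ∈ Finset.Icc 1 K, g k ≤
      (1 + a₀ ^ 2 * c) * (Real.exp (2 * (a₀ ^ 2 * c)) * F₀) / (a₀ * J) / √(K : ℝ) ∧
    (1 / (K : ℝ)) * ∑ k ∈ Finset.Icc 1 K, D k ≤
      (2 + 2 * (a₀ ^ 2 * c) + a₀ * J * b) * (Real.exp (2 * (a₀ ^ 2 * c)) * F₀) /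
        (K : ℝ) ^ (3 / 4 : ℝ) := by
  have hK' : (0 : ℝ) < K := by exact_mod_cast hK
  have hK1 : (1 : ℝ) ≤ K := by exact_mod_cast hK
  have hJ' : (0 : ℝ) < J := by exact_mod_cast hJ
  set A := Real.exp (2 * (a₀ ^ 2 * c)) * F₀ with hA
  have hA0 : 0 ≤ A := mul_nonneg (Real.exp_pos _).le (hF0 ▸ hF 0)
  set η := a₀ / √(K : ℝ) with hη
  have hη0 : 0 < η := by positivity
  have hη2 : η ^ 2 * c = a₀ ^ 2 * c / K := by
    rw [hη, div_pow, Real.sq_sqrt hK'.le]; ring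
  -- The objective grows at most exponentially, at rate `c η ^ 2 = O(1 / K)`.
  have hpow : ∀ k, F k ≤ Real.exp (k * (η ^ 2 * c)) * F₀ := by
    intro k
    induction k with
    | zero => simp [hF0]
    | succ k ih =>
      have h1 : 0 ≤ η * J * g k := mul_nonneg (by positivity) (hg k)
      have h2 : 1 + η ^ 2 * c ≤ Real.exp (η ^ 2 * c) := by
        rw [add_comm]; exact Real.add_one_le_exp _
      calc F (k + 1) ≤ (1 + η ^ 2 * c) * F k := by linarith [hrec k]
        _ ≤ Real.exp (η ^ 2 * c) * (Real.exp (k * (η ^ 2 * c)) * F₀) :=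
          mul_le_mul h2 ih (hF k) (Real.exp_pos _).le
        _ = _ := by
          rw [← mul_assoc, ← Real.exp_add]
          push_cast
          ring_nf
  have hFA : ∀ k ∈ Finset.Icc 1 K, F k ≤ A := by
    intro k hk
    refine (hpow k).trans ?_
    have hkK : (k : ℝ) ≤ K := by exact_mod_cast (Finset.mem_Icc.1 hk).2
    have : (k : ℝ) * (η ^ 2 * c) ≤ 2 * (a₀ ^ 2 * c) := by
      rw [hη2]
      calc (k : ℝ) * (a₀ ^ 2 * c / K) ≤ K * (a₀ ^ 2 * c / K) := by gcongr
        _ = a₀ ^ 2 * c := by field_simp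
        _ ≤ _ := by nlinarith [mul_nonneg (sq_nonneg a₀) hc]
    rw [hA]
    exact mul_le_mul_of_nonneg_right (Real.exp_le_exp.2 this) (hF0 ▸ hF 0)
  have hsumF : ∑ k ∈ Finset.Icc 1 K, F k ≤ K * A := by
    refine (Finset.sum_le_sum hFA).trans (le_of_eq ?_)
    simp
  have htel : ∑ k ∈ Finset.Icc 1 K, (F k - F (k + 1)) ≤ A := by
    have h : ∑ k ∈ Finset.Icc 1 K, (F k - F (k + 1)) = F 1 - F (K + 1) := by
      rw [← Finset.Ico_add_one_right_eq_Icc, ← neg_inj, ← Finset.sum_neg_distrib]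
      simp only [neg_sub]
      rw [Finset.sum_Ico_sub F (by omega)]
    rw [h]
    linarith [hF (K + 1), hFA 1 (by simp; omega)]
  have hmain : ∑ k ∈ Finset.Icc 1 K, ((1 + η ^ 2 * c) * F k - F (k + 1)) ≤
      (1 + a₀ ^ 2 * c) * A := by
    have h : ∑ k ∈ Finset.Icc 1 K, ((1 + η ^ 2 * c) * F k - F (k + 1)) =
        ∑ k ∈ Finset.Icc 1 K, (F k - F (k + 1)) + η ^ 2 * c * ∑ k ∈ Finset.Icc 1 K, F k := by
      rw [Finset.mul_sum, ← Finset.sum_add_distrib]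
      exact Finset.sum_congr rfl fun k _ => by ring
    have h2 : η ^ 2 * c * ∑ k ∈ Finset.Icc 1 K, F k ≤ a₀ ^ 2 * c * A := by
      calc _ ≤ η ^ 2 * c * (K * A) := by gcongr
        _ = _ := by rw [hη2]; field_simp
    rw [h]
    linarith
  have hsumg : η * J * ∑ k ∈ Finset.Icc 1 K, g k ≤ (1 + a₀ ^ 2 * c) * A := by
    refine le_trans ?_ hmain
    rw [Finset.mul_sum]
    exact Finset.sum_le_sum fun k _ => by linarith [hrec k]
  constructor
  · have h1 : η * J = a₀ * J / √(K : ℝ) := by rw [hη]; ring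
    rw [h1, div_mul_eq_mul_div, div_le_iff₀ (by positivity)] at hsumg
    have h2 : √(K : ℝ) * √(K : ℝ) = K := Real.mul_self_sqrt hK'.le
    rw [one_div_mul_eq_div, div_div, div_le_div_iff₀ hK' (by positivity)]
    calc (∑ k ∈ Finset.Icc 1 K, g k) * (a₀ * J * √(K : ℝ))
        = (a₀ * J * ∑ k ∈ Finset.Icc 1 K, g k) * √(K : ℝ) := by ring
      _ ≤ ((1 + a₀ ^ 2 * c) * A * √(K : ℝ)) * √(K : ℝ) := by gcongr
      _ = _ := by rw [mul_assoc, h2]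
  · set s := (K : ℝ) ^ (1 / 4 : ℝ) with hs
    have hs0 : 0 < s := by positivity
    have hs1 : 1 ≤ s := Real.one_le_rpow hK1 (by norm_num)
    have hs2 : √(K : ℝ) = s ^ 2 := by
      rw [Real.sqrt_eq_rpow, hs, ← Real.rpow_natCast, ← Real.rpow_mul hK'.le]; norm_num
    have hs3 : (K : ℝ) ^ (3 / 4 : ℝ) = s ^ 3 := by
      rw [hs, ← Real.rpow_natCast, ← Real.rpow_mul hK'.le]; norm_num
    have hs4 : (K : ℝ) = s ^ 4 := by
      rw [hs, ← Real.rpow_natCast, ← Real.rpow_mul hK'.le]; norm_num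
    have h1 : ∑ k ∈ Finset.Icc 1 K, D k ≤ (1 + a₀ ^ 2 * c) * A +
        η * J * b / s * (K * A) + s * ((1 + a₀ ^ 2 * c) * A) := by
      calc ∑ k ∈ Finset.Icc 1 K, D k ≤ ∑ k ∈ Finset.Icc 1 K,
            ((1 + η ^ 2 * c) * F k - F (k + 1) + η * J * (b * F k / s + s * g k)) :=
            Finset.sum_le_sum fun k _ => hD s hs0 k
        _ = ∑ k ∈ Finset.Icc 1 K, ((1 + η ^ 2 * c) * F k - F (k + 1)) +
            η * J * b / s * ∑ k ∈ Finset.Icc 1 K, F k +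
            s * (η * J * ∑ k ∈ Finset.Icc 1 K, g k) := by
          simp only [Finset.mul_sum]
          rw [← Finset.sum_add_distrib, ← Finset.sum_add_distrib]
          exact Finset.sum_congr rfl fun k _ => by ring
        _ ≤ _ := by gcongr
    have h2 : η * J * b / s * (K * A) = s * (a₀ * J * b * A) := by
      rw [hη, hs2, hs4]; field_simp
    have h3 : 0 ≤ (1 + a₀ ^ 2 * c) * A := by positivity
    have h4 : ∑ k ∈ Finset.Icc 1 K, D k ≤
        s * ((2 + 2 * (a₀ ^ 2 * c) + a₀ * J * b) * A) := by
      rw [h2] at h1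
      nlinarith [mul_le_mul_of_nonneg_right hs1 h3]
    rw [one_div_mul_eq_div, hs3, div_le_div_iff₀ hK' (by positivity)]
    calc _ ≤ s * ((2 + 2 * (a₀ ^ 2 * c) + a₀ * J * b) * A) * s ^ 3 := by gcongr
      _ = _ := by rw [hs4]; ring

end Recursion

/-! ### The objective of the model -/

/-- The common marginal and the normalization of the log-loss only shift the objective. -/
theorem objective_eq_negLogLik_add {X Y Z : Type*} [MeasurableSpace Y] {T M d : ℕ}
    {μY : Measure Y} {p : Fin M → X × Y → ℝ≥0∞} [MeasurableSpace X] {pX : X → ℝ≥0∞}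
    (hmarg : ∀ m x, marginal μY (p m) x = pX x) (h : Theta d → X → Z) (ℓ : Z → Y → ℝ≥0) (c : ℝ)
    {n : Fin T → ℕ} (S : (t : Fin T) → Fin (n t) → X × Y)
    (hS : ∀ t i, 0 < pX (S t i).1 ∧ pX (S t i).1 < ∞) (Θ : Params M d)
    {W : Fin T → Fin M → ℝ} (hW : ∀ t, W t ∈ stdSimplex ℝ (Fin M)) :
    objective μY p h ℓ c S Θ W = negLogLik (sampleLoss h ℓ S) Θ W +
      -(1 / ((∑ t, n t : ℕ) : ℝ)) * ∑ t, ∑ i, Real.log ((pX (S t i).1).toReal * Real.exp c) := by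
  have hlik : ∀ t i, Real.log (likelihood μY p h ℓ c Θ (W t) (S t i)) =
      Real.log ((pX (S t i).1).toReal * Real.exp c) +
        Real.log (mixture (sampleLoss h ℓ S) Θ W t i) := by
    intro t i
    have hp : 0 < (pX (S t i).1).toReal := ENNReal.toReal_pos (hS t i).1.ne' (hS t i).2.ne
    rw [← Real.log_mul (mul_pos hp (Real.exp_pos c)).ne'
      (mixture_pos (sampleLoss h ℓ S) Θ hW t i).ne']
    congr 1
    rw [likelihood, mixture, Finset.mul_sum]
    refine Finset.sum_congr rfl fun m _ => ?_
    rw [hmarg, modelCond, sub_eq_add_neg, Real.exp_add, sampleLoss]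
    ring
  simp only [objective, negLogLik, hlik, Finset.sum_add_distrib, Finset.sum_neg_distrib]
  ring

theorem SmoothLosses.regularLosses {X Y Z : Type*} {T d : ℕ} [MeasurableSpace X]
    [MeasurableSpace Y] {h : Theta d → X → Z}
    {ℓ : Z → Y → ℝ≥0} {n : Fin T → ℕ} {S : (t : Fin T) → Fin (n t) → X × Y} {L : ℝ≥0}
    (hs : SmoothLosses (sampleLoss h ℓ S) L) : RegularLosses (sampleLoss h ℓ S) (L + 1) where
  pos := by positivity
  nonneg t i θ := NNReal.coe_nonneg _
  diff t i := (hs t i).1.differentiable (by norm_num)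
  lip t i θ θ' := by
    rw [← dist_eq_norm, ← dist_eq_norm]
    refine ((hs t i).2.dist_le_mul θ θ').trans ?_
    gcongr
    linarith

end FedEM

theorem theorem1
    {X Y Z 𝒯 : Type*} [MeasurableSpace X] [MeasurableSpace Y] [AddCommGroup Z] [Module ℝ Z]
    [Countable 𝒯] {T M d : ℕ}
    -- distributions: local ones, components with their densities, mixture weights
    (μX : Measure X) [SigmaFinite μX] (μY : Measure Y) [SigmaFinite μY]
    (D : 𝒯 → Measure (X × Y)) [∀ t, IsProbabilityMeasure (D t)]
    (D' : Fin M → Measure (X × Y)) [∀ m, IsProbabilityMeasure (D' m)]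
    (p : Fin M → X × Y → ℝ≥0∞) (hp : ∀ m, Measurable (p m))
    (hD' : ∀ m, D' m = (μX.prod μY).withDensity (p m))
    (wstar : 𝒯 → Fin M → ℝ) (hmix : FedEM.IsMixture D D' wstar)
    -- identical marginals
    (pX : X → ℝ≥0∞) (hmarg : ∀ m x, FedEM.marginal μY (p m) x = pX x)
    -- hypotheses and log-loss
    (H : Set (X → Z)) (h : FedEM.Theta d → X → Z) (hH : convexHull ℝ (Set.range h) ⊆ H)
    (ℓ : Z → Y → ℝ≥0) (c : ℝ) (hlog : FedEM.LogLossRealizable μY D' p h ℓ c)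
    -- the participating clients and their datasets
    (client : Fin T ↪ 𝒯) (n : Fin T → ℕ) (hn : ∀ t, 0 < n t)
    (S : (t : Fin T) → Fin (n t) → X × Y)
    (hS : ∀ t i, 0 < pX (S t i).1 ∧ pX (S t i).1 < ∞)
    -- objective bounded below
    (fstar : ℝ)
    (hbdd : ∀ (Θ : FedEM.Params M d) (W : Fin T → Fin M → ℝ),
      (∀ t, W t ∈ stdSimplex ℝ (Fin M)) → fstar ≤ FedEM.objective μY p h ℓ c S Θ W)
    -- smoothness
    (L : ℝ≥0) (hsmooth : FedEM.SmoothLosses (FedEM.sampleLoss h ℓ S) L)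
    -- stochastic gradients
    (B : Fin T → ℕ) (hB : ∀ t, 0 < B t)
    (ν : (t : Fin T) → Measure (Fin (B t) → Fin (n t))) [∀ t, IsProbabilityMeasure (ν t)]
    (hν : FedEM.UniformBatches ν)
    (σ : ℝ) (hvar : FedEM.UnbiasedBoundedVariance (FedEM.sampleLoss h ℓ S) ν σ)
    -- bounded dissimilarity
    (G β : ℝ) (hdis : FedEM.BoundedDissimilarity M (FedEM.sampleLoss h ℓ S) G β)
    -- number of local steps, step size constant, initialization
    (J : ℕ) (hJ : 0 < J) (a₀ : ℝ) (ha₀ : 0 < a₀)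
    (Θ₀ : FedEM.Params M d) (W₀ : Fin T → Fin M → ℝ) (hW₀ : ∀ t, W₀ t ∈ stdSimplex ℝ (Fin M)) :
    ∃ (C : ℝ) (K₀ : ℕ), ∀ K : ℕ, K₀ ≤ K →
      ∀ (Ω : Type*) [MeasurableSpace Ω] (P : Measure Ω) [IsProbabilityMeasure P]
        (ξ : ℕ → ℕ → (t : Fin T) → Ω → Fin M → Fin (B t) → Fin (n t)),
        FedEM.IsBatchSampling P ν ξ →
        let f := FedEM.objective μY p h ℓ c S
        let it := fun (k : ℕ) (ω : Ω) =>
          FedEM.iterates (FedEM.sampleLoss h ℓ S) J (a₀ / √(K : ℝ))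
            (fun k j t => ξ k j t ω) Θ₀ W₀ k
        let gradSq := fun (k : ℕ) (ω : Ω) =>
          ‖gradient (fun Θ => f Θ (it k ω).2) (it k ω).1‖ ^ 2
        let Δ := fun (k : ℕ) (ω : Ω) =>
          f (it k ω).1 (it k ω).2 - f (it k ω).1 (it (k + 1) ω).2
        (∀ k, Integrable (gradSq k) P) ∧
        (1 / (K : ℝ)) * ∑ k ∈ Finset.Icc 1 K, ∫ ω, gradSq k ω ∂P ≤ C / √(K : ℝ) ∧
        (∀ k ω, 0 ≤ Δ k ω) ∧
        (∀ k, Integrable (Δ k) P) ∧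
        (1 / (K : ℝ)) * ∑ k ∈ Finset.Icc 1 K, ∫ ω, Δ k ω ∂P ≤ C / (K : ℝ) ^ (3 / 4 : ℝ) := by
  rcases isEmpty_or_nonempty (Fin T) with hT | hT
  · -- Without clients the objective is identically zero.
    refine ⟨0, 0, fun K _ Ω _ P _ ξ _ => ?_⟩
    simp [FedEM.objective]
  set l := FedEM.sampleLoss h ℓ S with hldef
  have hl : FedEM.RegularLosses l (L + 1) := hsmooth.regularLosses
  set F₀ := FedEM.negLogLik l Θ₀ W₀ with hF₀
  set cst := FedEM.roundConst n M J ((L : ℝ) + 1) with hcst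
  set b : ℝ := M * (4 * ((L : ℝ) + 1) * ((∑ t, n t : ℕ) : ℝ)) with hb
  set A := Real.exp (2 * (a₀ ^ 2 * cst)) * F₀ with hA
  set C₁ := (1 + a₀ ^ 2 * cst) * A / (a₀ * J) with hC₁
  set C₂ := (2 + 2 * (a₀ ^ 2 * cst) + a₀ * J * b) * A with hC₂
  -- `K₀` is chosen such that `K₀ > 0` and `a₀ / √K * (L + 1) ≤ 1` for all `K ≥ K₀`.
  refine ⟨max C₁ C₂, ⌈(a₀ * (L + 1)) ^ 2⌉₊ + 1, fun K hK Ω _ P _ ξ hξ => ?_⟩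
  intro f it gradSq Δ
  have hK0 : 0 < K := by omega
  have hK' : (0 : ℝ) < K := by exact_mod_cast hK0
  have hη : 0 ≤ a₀ / √(K : ℝ) := by positivity
  have hηΛ : a₀ / √(K : ℝ) * (L + 1) ≤ 1 := by
    rw [div_mul_eq_mul_div, div_le_one (by positivity)]
    refine Real.le_sqrt_of_sq_le ((Nat.le_ceil _).trans ?_)
    exact_mod_cast (Nat.le_succ _).trans hK
  have hW : ∀ k ω t, (it k ω).2 t ∈ stdSimplex ℝ (Fin M) := fun k ω =>
    FedEM.iterates_weights_mem hn J _ _ Θ₀ hW₀ k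
  have hobj := fun (Θ : FedEM.Params M d) {W : Fin T → Fin M → ℝ}
      (hW : ∀ t, W t ∈ stdSimplex ℝ (Fin M)) =>
    FedEM.objective_eq_negLogLik_add hmarg h ℓ c S hS Θ hW
  have hgrad : ∀ k, gradSq k = fun ω => ‖FedEM.mixGrad l (it k ω).1 (it k ω).2‖ ^ 2 := by
    intro k
    funext ω
    have hg := (FedEM.hasGradientAt_negLogLik hl (hW k ω) (it k ω).1).hasFDerivAt.add_const
      (-(1 / ((∑ t, n t : ℕ) : ℝ)) * ∑ t, ∑ i, Real.log ((pX (S t i).1).toReal * Real.exp c))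
    have hfun : (fun Θ => f Θ (it k ω).2) = fun Θ => FedEM.negLogLik l Θ (it k ω).2 +
        -(1 / ((∑ t, n t : ℕ) : ℝ)) * ∑ t, ∑ i, Real.log ((pX (S t i).1).toReal * Real.exp c) :=
      funext fun Θ => hobj Θ (hW k ω)
    simp only [gradSq]
    rw [hfun, (hasGradientAt_iff_hasFDerivAt.2 hg).gradient]
  have hΔ : ∀ k, Δ k = fun ω => FedEM.negLogLik l (it k ω).1 (it k ω).2 -
      FedEM.negLogLik l (it k ω).1 (it (k + 1) ω).2 := by
    intro k
    funext ω
    simp only [Δ, f]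
    rw [hobj _ (hW k ω), hobj _ (hW (k + 1) ω)]
    ring
  have hrates := FedEM.rates_of_recursion (b := b) (F₀ := F₀)
    (F := fun k => ∫ ω, FedEM.negLogLik l (it k ω).1 (it k ω).2 ∂P)
    (g := fun k => ∫ ω, gradSq k ω ∂P) (D := fun k => ∫ ω, Δ k ω ∂P)
    (FedEM.roundConst_nonneg n M J hl.pos.le) (by positivity) ha₀ hJ hK0
    (fun k => integral_nonneg fun ω => FedEM.negLogLik_nonneg hl (hW k ω))
    (fun k => integral_nonneg fun ω => by positivity)
    (by simp [it, FedEM.iterates, hF₀])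
    (fun k => by
      simp only [hgrad]
      exact FedEM.integral_negLogLik_succ_le hl hξ hν hn hB hW₀ J hη hηΛ k)
    (fun s hs k => by
      simp only [hgrad, hΔ]
      exact FedEM.integral_weight_decrease_le hl hξ hν hn hB hW₀ J hη hηΛ hs k)
  refine ⟨fun k => ?_, hrates.1.trans ?_, fun k ω => ?_, fun k => ?_, hrates.2.trans ?_⟩
  · rw [hgrad]
    exact FedEM.integrable_iterates hξ l J _ Θ₀ W₀ k fun s => ‖FedEM.mixGrad l s.1 s.2‖ ^ 2
  · exact div_le_div_of_nonneg_right (le_max_left _ _) (Real.sqrt_nonneg _)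
  · rw [hΔ]
    exact sub_nonneg.2 (FedEM.negLogLik_weightStep_le hn (hW k ω))
  · rw [hΔ]
    exact FedEM.integrable_iterates hξ l J _ Θ₀ W₀ k fun s => FedEM.negLogLik l s.1 s.2 -
      FedEM.negLogLik l s.1 (FedEM.weightStep l s.1 s.2)
  · exact div_le_div_of_nonneg_right (le_max_right _ _) (by positivity)
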